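/- Let $L>0$, $\omega,c\in\mathbb R$ with $1-c^2>0$, put $\nu=-(\omega+c^2/4)$ and assume $\nu>2\pi^2/L^2$. For $0\le k<1$ let $K(k)=\int_0^{\pi/2}\frac{dt}{\sqrt{1-k^2\sin^2t}}$ be the complete elliptic integral of the first kind and $\mathrm{dn}(\cdot;k)$ the Jacobi elliptic function. Let $0<\eta_2<\eta_1$ satisfy $\eta_1^2+\eta_2^2=2\nu(1-c^2)$ and $$\frac{2\sqrt{2(1-c^2)}}{\eta_1}K(k)=L,\qquad k=\sqrt{\frac{\eta_1^2-\eta_2^2}{\eta_1^2}},$$ and let $$\phi(\xi)=\eta_1\,\mathrm{dn}\Big(\tfrac{\eta_1\xi}{\sqrt{2(1-c^2)}};k\Big),\qquad \psi(\xi)=-\frac{\eta_1^2}{1-c^2}\,\mathrm{dn}^2\Big(\tfrac{\eta_1\xi}{\sqrt{2(1-c^2)}};k\Big)$$ be the corresponding $L$-periodic dnoidal waves. Consider the operators $$\mathcal L_3=-\frac{d^2}{dx^2}-\Big(\omega+\frac{c^2}{4}\Big)+3\psi,\qquad \mathcal L_4=-\frac{d^2}{dx^2}-\Big(\omega+\frac{c^2}{4}\Big)+\psi$$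 in the complex space $L^2_{per}([0,L])$ with domain $H^2_{per}([0,L])$. Then: (i) The spectrum of $\mathcal L_3$ is a set $\{\lambda_0<\lambda_1<\lambda_2<\cdots\}$ of real eigenvalues with $\lambda_n\to+\infty$. The first three eigenvalues $\lambda_0,\lambda_1,\lambda_2$ are simple (one-dimensional eigenspaces), $\lambda_1=0$ with eigenspace spanned by $\phi'$, and all the others, $\lambda_n$ with $n\ge 3$, are double (two-dimensional eigenspaces). (ii) The spectrum of $\mathcal L_4$ is a set $\{\mu_0<\mu_1<\mu_2<\cdots\}$ of real eigenvalues of finite multiplicity with $\mu_n\to+\infty$. The first eigenvalue is $\mu_0=0$; it is simple, with eigenspace spanned by $\phi$. -/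

import Mathlib

open MeasureTheory Filter

noncomputable section

/-! ## Jacobi elliptic functions -/

/-- The incomplete elliptic integral of the first kind `F(θ, k) = ∫₀^θ dt / √(1 - k² sin² t)`. -/
def ellipticF (θ k : ℝ) : ℝ :=
  ∫ t in (0 : ℝ)..θ, 1 / √(1 - k ^ 2 * Real.sin t ^ 2)

/-- The complete elliptic integral of the first kind `K(k) = F(π/2, k)`. -/
def ellipticK (k : ℝ) : ℝ := ellipticF (Real.pi / 2) k

/-- The Jacobi amplitude: `am(·, k)` is the inverse function of `F(·, k)`.
For `k ^ 2 < 1` the latter is a bijection of `ℝ`, see `ellipticF_bijective`. -/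
def jacobiAm (u k : ℝ) : ℝ := Function.invFun (fun θ => ellipticF θ k) u

/-- The Jacobi elliptic function `sn(u; k)`. -/
def jacobiSn (u k : ℝ) : ℝ := Real.sin (jacobiAm u k)

/-- The Jacobi elliptic function `dn(u; k)`. -/
def jacobiDn (u k : ℝ) : ℝ := √(1 - k ^ 2 * jacobiSn u k ^ 2)

theorem ellipticF_integrand_pos {k : ℝ} (hk : k ^ 2 < 1) (t : ℝ) :
    0 < 1 - k ^ 2 * Real.sin t ^ 2 := by
  nlinarith [Real.sin_sq_le_one t, sq_nonneg k, sq_nonneg (Real.sin t)]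

theorem ellipticF_hasDerivAt {k : ℝ} (hk : k ^ 2 < 1) (θ : ℝ) :
    HasDerivAt (fun θ => ellipticF θ k) (1 / √(1 - k ^ 2 * Real.sin θ ^ 2)) θ := by
  have hc : Continuous fun t : ℝ => 1 / √(1 - k ^ 2 * Real.sin t ^ 2) := by
    refine continuous_const.div (by fun_prop) fun t => ?_
    exact (Real.sqrt_pos.2 (ellipticF_integrand_pos hk t)).ne'
  exact intervalIntegral.integral_hasDerivAt_right (hc.intervalIntegrable _ _)
    (hc.stronglyMeasurableAtFilter _ _) hc.continuousAt

theorem ellipticF_bijective {k : ℝ} (hk : k ^ 2 < 1) :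
    Function.Bijective (fun θ => ellipticF θ k) := by
  have hge : ∀ t : ℝ, 1 ≤ 1 / √(1 - k ^ 2 * Real.sin t ^ 2) := fun t => by
    rw [le_div_iff₀ (Real.sqrt_pos.2 (ellipticF_integrand_pos hk t)), one_mul]
    exact Real.sqrt_le_one.2 (by nlinarith [mul_nonneg (sq_nonneg k) (sq_nonneg (Real.sin t))])
  have hd := fun θ => ellipticF_hasDerivAt hk θ
  have hm : Monotone fun θ => ellipticF θ k - θ := by
    refine monotone_of_hasDerivAt_nonneg (fun θ => (hd θ).sub (hasDerivAt_id θ)) fun θ => ?_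
    simpa using hge θ
  have h0 : ellipticF 0 k = 0 := by simp [ellipticF]
  constructor
  · refine StrictMono.injective fun a b hab => ?_
    have := hm hab.le
    dsimp only at this ⊢
    linarith
  · refine Continuous.surjective
      (continuous_iff_continuousAt.2 fun θ => (hd θ).continuousAt) ?_ ?_
    · refine tendsto_atTop_mono' _ ?_ tendsto_id
      filter_upwards [eventually_ge_atTop (0 : ℝ)] with θ hθ
      have := hm hθ
      simp only [h0] at this
      simp only [id]
      linarith
    · refine tendsto_atBot_mono' _ ?_ tendsto_id
      filter_upwards [eventually_le_atBot (0 : ℝ)] with θ hθ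
      have := hm hθ
      simp only [h0] at this
      simp only [id]
      linarith

/-! ## The dnoidal waves -/

/-- The modulus `k ≥ 0` with `k² = (η₁² - η₂²) / η₁²`. -/
def dnoidalModulus (η₁ η₂ : ℝ) : ℝ := √((η₁ ^ 2 - η₂ ^ 2) / η₁ ^ 2)

/-- The fundamental period `(2 √(2 (1 - c²)) / η₁) K(k)` of the dnoidal waves. -/
def dnoidalPeriod (c η₁ η₂ : ℝ) : ℝ :=
  2 * √(2 * (1 - c ^ 2)) / η₁ * ellipticK (dnoidalModulus η₁ η₂)

/-- `φ(ξ) = η₁ dn(η₁ ξ / √(2 (1 - c²)); k)`. -/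
def dnoidalPhi (c η₁ η₂ ξ : ℝ) : ℝ :=
  η₁ * jacobiDn (η₁ * ξ / √(2 * (1 - c ^ 2))) (dnoidalModulus η₁ η₂)

/-- `ψ(ξ) = -(η₁² / (1 - c²)) dn²(η₁ ξ / √(2 (1 - c²)); k)`. -/
def dnoidalPsi (c η₁ η₂ ξ : ℝ) : ℝ :=
  -(η₁ ^ 2 / (1 - c ^ 2)) *
    jacobiDn (η₁ * ξ / √(2 * (1 - c ^ 2))) (dnoidalModulus η₁ η₂) ^ 2

/-! ## Unbounded operators: eigenspaces and spectrum -/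

section Unbounded

variable {E : Type*} [NormedAddCommGroup E] [NormedSpace ℂ E]

/-- The eigenspace `ker (T - z)`, as a subspace of the ambient space. -/
def pmapEigenspace (T : E →ₗ.[ℂ] E) (z : ℂ) : Submodule ℂ E where
  carrier := {x | ∃ h : x ∈ T.domain, T ⟨x, h⟩ = z • x}
  zero_mem' := ⟨T.domain.zero_mem, by
    rw [smul_zero]; exact T.map_zero⟩
  add_mem' := by
    rintro x y ⟨hx, ex⟩ ⟨hy, ey⟩
    refine ⟨T.domain.add_mem hx hy, ?_⟩
    rw [smul_add, ← ex, ← ey]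
    exact T.map_add ⟨x, hx⟩ ⟨y, hy⟩
  smul_mem' := by
    rintro a x ⟨hx, ex⟩
    refine ⟨T.domain.smul_mem a hx, ?_⟩
    rw [smul_comm, ← ex]
    exact T.map_smul a ⟨x, hx⟩

/-- The resolvent set: those `z` for which `T - z` is a bijection from the domain of `T`
onto the whole space with a bounded inverse `R`. -/
def pmapResolventSet (T : E →ₗ.[ℂ] E) : Set ℂ :=
  {z | ∃ R : E →L[ℂ] E,
    (∀ y : E, ∃ h : R y ∈ T.domain, T ⟨R y, h⟩ - z • R y = y) ∧
    ∀ x : T.domain, R (T x - z • (x : E)) = x}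

/-- The spectrum, the complement of the resolvent set. -/
def pmapSpectrum (T : E →ₗ.[ℂ] E) : Set ℂ := (pmapResolventSet T)ᶜ

end Unbounded

/-! ## Periodic Sobolev space and Hill operators -/

section Periodic

variable (L : ℝ) [Fact (0 < L)]

/-- `L²_per([0, L])`: complex-valued square-integrable functions on the circle `ℝ / Lℤ`.
(Haar measure is Lebesgue measure divided by `L`, which only rescales the norm.) -/
abbrev L2per : Type := Lp ℂ 2 (AddCircle.haarAddCircle (T := L))

/-- `H²_per([0, L])`: those `f` with `((1 + n²) f̂(n))ₙ ∈ ℓ²(ℤ)`. -/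
def H2per : Submodule ℂ (L2per L) where
  carrier := {f | Memℓp (fun n : ℤ => (1 + (n : ℂ) ^ 2) * fourierCoeff f n) 2}
  zero_mem' := by
    have h : (fun n : ℤ => (1 + (n : ℂ) ^ 2) * fourierCoeff (0 : L2per L) n) = 0 := by
      funext n
      rw [← fourierBasis_repr]
      simp
    simp only [Set.mem_ofPred_eq, h]
    exact zero_memℓp
  add_mem' := by
    intro f g hf hg
    have h : (fun n : ℤ => (1 + (n : ℂ) ^ 2) * fourierCoeff (f + g : L2per L) n) =
        (fun n : ℤ => (1 + (n : ℂ) ^ 2) * fourierCoeff f n) +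
          fun n : ℤ => (1 + (n : ℂ) ^ 2) * fourierCoeff g n := by
      funext n
      simp only [Pi.add_apply, ← fourierBasis_repr, map_add, lp.coeFn_add, mul_add]
    simp only [Set.mem_ofPred_eq, h]
    exact Memℓp.add hf hg
  smul_mem' := by
    intro a f hf
    have h : (fun n : ℤ => (1 + (n : ℂ) ^ 2) * fourierCoeff (a • f : L2per L) n) =
        a • fun n : ℤ => (1 + (n : ℂ) ^ 2) * fourierCoeff f n := by
      funext n
      simp only [Pi.smul_apply, ← fourierBasis_repr, map_smul, lp.coeFn_smul, smul_eq_mul]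
      ring
    simp only [Set.mem_ofPred_eq, h]
    exact Memℓp.const_smul hf a

theorem memℓp_secondDeriv (f : H2per L) :
    Memℓp (fun n : ℤ => -(2 * (Real.pi : ℂ) * n / L) ^ 2 * fourierCoeff (f : L2per L) n) 2 := by
  have hf : Memℓp (fun n : ℤ => (1 + (n : ℂ) ^ 2) * fourierCoeff (f : L2per L) n) 2 := f.2
  have hf' := Memℓp.const_smul hf ((2 * Real.pi / L) ^ 2 : ℝ)
  refine memℓp_gen ?_
  refine Summable.of_nonneg_of_le (fun n => by positivity) (fun n => ?_)
    (hf'.summable (by norm_num))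
  refine Real.rpow_le_rpow (norm_nonneg _) ?_ (by norm_num)
  have e : ‖(1 + (n : ℂ) ^ 2)‖ = 1 + (n : ℝ) ^ 2 := by
    have : (1 + (n : ℂ) ^ 2) = ((1 + (n : ℝ) ^ 2 : ℝ) : ℂ) := by push_cast; ring
    rw [this, Complex.norm_of_nonneg (by positivity)]
  have e' : ‖-(2 * (Real.pi : ℂ) * n / L) ^ 2‖ = (2 * Real.pi / L) ^ 2 * (n : ℝ) ^ 2 := by
    have : (-(2 * (Real.pi : ℂ) * n / L) ^ 2) =
        ((-((2 * Real.pi / L) ^ 2 * (n : ℝ) ^ 2) : ℝ) : ℂ) := by push_cast; ring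
    rw [this, Complex.norm_real, norm_neg, Real.norm_of_nonneg (by positivity)]
  simp only [Pi.smul_apply, norm_smul, norm_mul, e, e',
    Real.norm_of_nonneg (sq_nonneg (2 * Real.pi / L))]
  rw [← mul_assoc]
  refine mul_le_mul_of_nonneg_right ?_ (norm_nonneg _)
  exact mul_le_mul_of_nonneg_left (by linarith) (by positivity)

/-- The (distributional) second derivative `H²_per → L²_per`, which multiplies the `n`-th
Fourier coefficient by `(2 π i n / L)² = -(2 π n / L)²`. -/
def secondDeriv : H2per L →ₗ[ℂ] L2per L where
  toFun f := fourierBasis.repr.symm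
    ⟨fun n : ℤ => -(2 * (Real.pi : ℂ) * n / L) ^ 2 * fourierCoeff (f : L2per L) n,
      memℓp_secondDeriv L f⟩
  map_add' f g := by
    rw [← map_add]
    congr 1
    ext n
    simp only [lp.coeFn_add, Pi.add_apply, Submodule.coe_add, ← fourierBasis_repr, map_add,
      mul_add]
  map_smul' a f := by
    rw [RingHom.id_apply, ← map_smul]
    congr 1
    ext n
    simp only [lp.coeFn_smul, Pi.smul_apply, Submodule.coe_smul, ← fourierBasis_repr, map_smul,
      smul_eq_mul]
    ring

/-- Multiplication of `f ∈ L²_per` by an `L`-periodic real function `V`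
(given by its values on `[0, L)`). -/
def potentialMul (V : ℝ → ℝ) (f : L2per L) : AddCircle L → ℂ :=
  fun x => AddCircle.liftIco L 0 (fun t : ℝ => (V t : ℂ)) x * f x

theorem potentialMul_add (V : ℝ → ℝ) (f g : L2per L) :
    potentialMul L V (f + g) =ᵐ[AddCircle.haarAddCircle]
      potentialMul L V f + potentialMul L V g := by
  filter_upwards [Lp.coeFn_add f g] with x hx
  simp only [potentialMul, Pi.add_apply, hx, mul_add]

theorem potentialMul_smul (V : ℝ → ℝ) (a : ℂ) (f : L2per L) :
    potentialMul L V (a • f) =ᵐ[AddCircle.haarAddCircle] a • potentialMul L V f := by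
  filter_upwards [Lp.coeFn_smul a f] with x hx
  simp only [potentialMul, Pi.smul_apply, hx, smul_eq_mul]
  ring

/-- Those `f ∈ H²_per` with `V f ∈ L²`; this is all of `H²_per` when `V` is bounded and
measurable. -/
def hillDomain (V : ℝ → ℝ) : Submodule ℂ (L2per L) where
  carrier := {f | f ∈ H2per L ∧ MemLp (potentialMul L V f) 2 AddCircle.haarAddCircle}
  zero_mem' := by
    refine ⟨(H2per L).zero_mem, MemLp.ae_eq ?_ MemLp.zero⟩
    filter_upwards [Lp.coeFn_zero ℂ 2 (AddCircle.haarAddCircle (T := L))] with x hx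
    simp only [potentialMul, hx, Pi.zero_apply, mul_zero]
  add_mem' := by
    rintro f g ⟨hf, hf'⟩ ⟨hg, hg'⟩
    exact ⟨(H2per L).add_mem hf hg, (hf'.add hg').ae_eq (potentialMul_add L V f g).symm⟩
  smul_mem' := by
    rintro a f ⟨hf, hf'⟩
    exact ⟨(H2per L).smul_mem a hf,
      (hf'.const_smul a).ae_eq (potentialMul_smul L V a f).symm⟩

/-- The Hill operator `-d²/dx² + V` in `L²_per([0, L])`. -/
def hillOperator (V : ℝ → ℝ) : L2per L →ₗ.[ℂ] L2per L where
  domain := hillDomain L V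
  toFun :=
    { toFun := fun f => -secondDeriv L ⟨f, f.2.1⟩ + f.2.2.toLp (potentialMul L V f)
      map_add' := by
        intro f g
        have h1 : secondDeriv L ⟨(f + g : hillDomain L V), (f + g).2.1⟩ =
            secondDeriv L ⟨f, f.2.1⟩ + secondDeriv L ⟨g, g.2.1⟩ := by
          rw [← map_add]; rfl
        have h2 : (f + g).2.2.toLp (potentialMul L V (f + g : hillDomain L V)) =
            f.2.2.toLp (potentialMul L V f) + g.2.2.toLp (potentialMul L V g) := by
          rw [← MemLp.toLp_add]
          exact MemLp.toLp_congr _ _ (potentialMul_add L V f g)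
        rw [h1, h2]
        abel
      map_smul' := by
        intro a f
        have h1 : secondDeriv L ⟨(a • f : hillDomain L V), (a • f).2.1⟩ =
            a • secondDeriv L ⟨f, f.2.1⟩ := by
          rw [← map_smul]; rfl
        have h2 : (a • f).2.2.toLp (potentialMul L V (a • f : hillDomain L V)) =
            a • f.2.2.toLp (potentialMul L V f) := by
          rw [← MemLp.toLp_const_smul]
          exact MemLp.toLp_congr _ _ (potentialMul_smul L V a f)
        rw [h1, h2, RingHom.id_apply, smul_add, smul_neg] }

/-- `𝓛₃ = -d²/dx² - (ω + c²/4) + 3 ψ`. -/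
def operatorL3 (ω c η₁ η₂ : ℝ) : L2per L →ₗ.[ℂ] L2per L :=
  hillOperator L fun x => -(ω + c ^ 2 / 4) + 3 * dnoidalPsi c η₁ η₂ x

/-- `𝓛₄ = -d²/dx² - (ω + c²/4) + ψ`. -/
def operatorL4 (ω c η₁ η₂ : ℝ) : L2per L →ₗ.[ℂ] L2per L :=
  hillOperator L fun x => -(ω + c ^ 2 / 4) + dnoidalPsi c η₁ η₂ x

/-- `e` is the element of `L²_per([0, L])` represented by the `L`-periodic real function `u`. -/
def IsClassOf (e : L2per L) (u : ℝ → ℝ) : Prop :=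
  e =ᵐ[AddCircle.haarAddCircle] AddCircle.liftIco L 0 (fun t : ℝ => (u t : ℂ))

end Periodic

end

section

open scoped NNReal Topology

noncomputable section

/-! ## Real second order linear equations -/

/-! Put `s = η₁ / √(2 (1 - c²))` and `κ = k²`. Then `-(ω + c²/4) = s² (2 - κ)` and `ψ = -2 s² dn²`,
so 𝓛₃ and 𝓛₄ are Lamé operators `-d²/dx² + s² (2 - κ) - N s² dn²(s x)` with `N = 6` and `N = 2`, on
the period `L = 2 K / s`.

For large `C` a Neumann series around `(C - d²/dx²)⁻¹`, which is diagonal in the Fourier basis,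
inverts a Hill operator shifted by `C`. The inverse is compact and symmetric, whence a discrete real
spectrum, bounded below (`hillOperator_spectrum`). Eigenfunctions in `H²_per` are classical, so
eigenvalue questions become questions about real `L`-periodic solutions of `y'' = (V - t) y`, and
multiplicities are at most two.

For 𝓛₄ the wave `φ` is a positive periodic solution at `t = 0`. Comparing any periodic eigenfunction
with `φ` (`wronskian_eq_zero_of_pos`) excludes `t < 0` and shows that the kernel is spanned by `φ`.

For 𝓛₃ the equation is `y'' = s² (6 κ sn² - m) y` with `m = 4 + κ + t / s²`. It has five explicit
Lamé solutions: `1 - a sn²` for two values of `a` and `sn cn` are `L`-periodic, while `cn dn` and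
`sn dn` are antiperiodic. Two facts settle the multiplicities.

(1) A quadratic polynomial `F` in `sn²` solves `F''' = 4 q F' + 2 q' F`, so `T = F d/dx - F'/2` acts
on the solution space and commutes with the monodromy. The first integral `R = F F''/2 - F'²/4 - q
F²` is the determinant of `T`, and it is a multiple of the quintic in `m` whose roots are the five
band edges. Where `R ≠ 0`, the monodromy cannot be a nontrivial Jordan block, so one periodic
solution makes all solutions periodic (`periodic_of_ne`). Antiperiodic edges carry no periodic
solution at all. Hence periodic eigenvalues other than the three explicit ones are double.

(2) Sturm comparison shows that up to the largest explicit periodic edge some solution is not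
periodic (`exists_not_periodic`). So the three explicit eigenvalues are simple and every double one
lies above them. The middle one, `m = 4 + κ`, is `t = 0`, with eigenfunction `sn cn`, a multiple of
`φ'`. -/

/-- `y` solves `y'' = q y` on the real line, with derivative `y'`. -/
structure IsSol (q y y' : ℝ → ℝ) : Prop where
  deriv_fst : ∀ x, HasDerivAt y (y' x) x
  deriv_snd : ∀ x, HasDerivAt y' (q x * y x) x

theorem abs_cos_sq_sub_cos_sq_le (a b : ℝ) : |Real.cos a ^ 2 - Real.cos b ^ 2| ≤ |a - b| := by
  have h : Real.cos a ^ 2 - Real.cos b ^ 2 = -(Real.sin (a + b) * Real.sin (a - b)) := by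
    rw [Real.sin_add, Real.sin_sub]
    linear_combination Real.cos b ^ 2 * Real.sin_sq_add_cos_sq a
      - Real.cos a ^ 2 * Real.sin_sq_add_cos_sq b
  rw [h, abs_neg, abs_mul]
  calc |Real.sin (a + b)| * |Real.sin (a - b)| ≤ 1 * |a - b| :=
        mul_le_mul (Real.abs_sin_le_one _) Real.abs_sin_le_abs (abs_nonneg _) zero_le_one
    _ = |a - b| := one_mul _

theorem abs_pruefer_sub_le {p Q : ℝ} (hQ : |p| ≤ Q) (a b : ℝ) :
    |((1 + p) * Real.cos a ^ 2 - p) - ((1 + p) * Real.cos b ^ 2 - p)| ≤ (1 + Q) * |a - b| := by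
  rw [sub_sub_sub_cancel_right, ← mul_sub, abs_mul]
  refine mul_le_mul ?_ (abs_cos_sq_sub_cos_sq_le a b) (abs_nonneg _)
    (by linarith [abs_nonneg p])
  calc |1 + p| ≤ |1| + |p| := abs_add_le _ _
    _ ≤ 1 + Q := by rw [abs_one]; linarith

theorem lipschitzWith_pruefer {p Q : ℝ} (hQ : |p| ≤ Q) :
    LipschitzWith (1 + Q).toNNReal fun a : ℝ => (1 + p) * Real.cos a ^ 2 - p := by
  refine LipschitzWith.of_dist_le_mul fun a b => ?_
  rw [Real.dist_eq, Real.dist_eq, Real.coe_toNNReal _ (by linarith [abs_nonneg p])]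
  exact abs_pruefer_sub_le hQ a b

theorem exists_pruefer_Icc {q : ℝ → ℝ} (hq : Continuous q) {Q : ℝ} (hQ : ∀ x, |q x| ≤ Q)
    (x₀ : ℝ) (N : ℕ) : ∃ θ : ℝ → ℝ, θ x₀ = 0 ∧ ∀ x ∈ Set.Ioo (x₀ - (N + 1)) (x₀ + (N + 1)),
      HasDerivAt θ ((1 + q x) * Real.cos (θ x) ^ 2 - q x) x := by
  have hQ0 : 0 ≤ Q := (abs_nonneg _).trans (hQ 0)
  have hmem : x₀ ∈ Set.Icc (x₀ - (N + 1)) (x₀ + (N + 1)) :=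
    ⟨by linarith [N.cast_nonneg (α := ℝ)], by linarith [N.cast_nonneg (α := ℝ)]⟩
  -- The vector field is bounded by `1 + 2 Q`, so over a time `N + 1` the angle moves by at most `(1
  -- + 2 Q) (N + 1)`. With this radius the local theorem covers the whole interval.
  have hP : IsPicardLindelof (fun t a : ℝ => (1 + q t) * Real.cos a ^ 2 - q t)
      (⟨x₀, hmem⟩ : Set.Icc (x₀ - (N + 1)) (x₀ + (N + 1))) (0 : ℝ)
      ((1 + 2 * Q).toNNReal * (N + 1)) 0 (1 + 2 * Q).toNNReal (1 + Q).toNNReal := by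
    refine ⟨fun t _ => (lipschitzWith_pruefer (hQ t)).lipschitzOnWith, fun a _ => ?_,
      fun t _ a _ => ?_, ?_⟩
    · exact Continuous.continuousOn (by fun_prop)
    · rw [Real.coe_toNNReal _ (by linarith), Real.norm_eq_abs, abs_le]
      have h1 := Real.cos_sq_le_one a
      have h2 := sq_nonneg (Real.cos a)
      obtain ⟨h3, h4⟩ := abs_le.1 (hQ t)
      constructor <;> nlinarith
    · simp
  obtain ⟨θ, h0, h⟩ := hP.exists_eq_forall_mem_Icc_hasDerivWithinAt₀
  exact ⟨θ, h0, fun x hx => (h x (Set.Ioo_subset_Icc_self hx)).hasDerivAt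
    (Icc_mem_nhds hx.1 hx.2)⟩

/-- Global existence for the Prüfer angle of `y'' = q y`. -/
theorem exists_pruefer {q : ℝ → ℝ} (hq : Continuous q) {Q : ℝ} (hQ : ∀ x, |q x| ≤ Q) (x₀ : ℝ) :
    ∃ θ : ℝ → ℝ, θ x₀ = 0 ∧
      ∀ x, HasDerivAt θ ((1 + q x) * Real.cos (θ x) ^ 2 - q x) x := by
  choose θ h0 hd using exists_pruefer_Icc hq hQ x₀
  have huniq : ∀ N M : ℕ, N ≤ M →
      Set.EqOn (θ N) (θ M) (Set.Ioo (x₀ - (N + 1)) (x₀ + (N + 1))) := by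
    intro N M hNM
    have hNM' : (N : ℝ) ≤ M := by exact_mod_cast hNM
    have hN : (0 : ℝ) ≤ N := N.cast_nonneg
    exact ODE_solution_unique_of_mem_Ioo (v := fun t a => (1 + q t) * Real.cos a ^ 2 - q t)
      (s := fun _ => Set.univ) (t₀ := x₀)
      (fun t _ => (lipschitzWith_pruefer (hQ t)).lipschitzOnWith)
      ⟨by linarith, by linarith⟩ (fun t ht => ⟨hd N t ht, trivial⟩)
      (fun t ht => ⟨hd M t ⟨by linarith [ht.1], by linarith [ht.2]⟩, trivial⟩)
      (by rw [h0, h0])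
  -- The half-lengths `N + 1` exceed the ceiling by one, so near any `x` the glued function agrees
  -- with a single local solution, also where the ceiling jumps.
  have hloc : ∀ (N : ℕ) (x : ℝ), |x - x₀| < N + 1 → θ ⌈|x - x₀|⌉₊ x = θ N x := by
    intro N x hx
    obtain ⟨h1, h2⟩ := abs_lt.1 hx
    obtain ⟨h3, h4⟩ := abs_le.1 (Nat.le_ceil |x - x₀|)
    rcases le_total ⌈|x - x₀|⌉₊ N with h | h
    · exact huniq _ _ h ⟨by linarith, by linarith⟩
    · exact (huniq _ _ h ⟨by linarith, by linarith⟩).symm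
  refine ⟨fun x => θ ⌈|x - x₀|⌉₊ x, h0 _, fun x => ?_⟩
  set N := ⌈|x - x₀|⌉₊ with hN
  have hx : |x - x₀| < N + 1 := by linarith [Nat.le_ceil |x - x₀|]
  obtain ⟨h1, h2⟩ := abs_lt.1 hx
  refine (hd N x ⟨by linarith, by linarith⟩).congr_of_eventuallyEq ?_
  have hopen : IsOpen {y : ℝ | |y - x₀| < N + 1} :=
    isOpen_lt (by fun_prop) continuous_const
  filter_upwards [hopen.mem_nhds hx] with y hy
  exact hloc N y hy

/-- The equation `y'' = q y` has a solution with `y x₀ = 0`, `y' x₀ = 1`. -/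
theorem exists_isSol {q : ℝ → ℝ} (hq : Continuous q) {Q : ℝ} (hQ : ∀ x, |q x| ≤ Q) (x₀ : ℝ) :
    ∃ y y' : ℝ → ℝ, IsSol q y y' ∧ y x₀ = 0 ∧ y' x₀ = 1 := by
  obtain ⟨θ, h0, hθ⟩ := exists_pruefer hq hQ x₀
  have hθc : Continuous θ := continuous_iff_continuousAt.2 fun x => (hθ x).continuousAt
  -- In Prüfer coordinates `y = r sin θ`, `y' = r cos θ`, this is `r' / r`; the amplitude is
  -- recovered by integrating and exponentiating.
  set g : ℝ → ℝ := fun x => (1 + q x) * (Real.sin (θ x) * Real.cos (θ x)) with hg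
  have hgc : Continuous g := by fun_prop
  have hρ : ∀ x, HasDerivAt (fun x => ∫ t in x₀..x, g t) (g x) x := fun x =>
    intervalIntegral.integral_hasDerivAt_right (hgc.intervalIntegrable _ _)
      (hgc.stronglyMeasurableAtFilter _ _) hgc.continuousAt
  have hr := fun x => (hρ x).exp
  refine ⟨fun x => Real.exp (∫ t in x₀..x, g t) * Real.sin (θ x),
    fun x => Real.exp (∫ t in x₀..x, g t) * Real.cos (θ x), ⟨fun x => ?_, fun x => ?_⟩, ?_, ?_⟩
  · convert! (hr x).mul (hθ x).sin using 1
    simp only [hg]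
    linear_combination (-Real.exp (∫ t in x₀..x, g t) * Real.cos (θ x) * (1 + q x)) *
      Real.sin_sq_add_cos_sq (θ x)
  · convert! (hr x).mul (hθ x).cos using 1
    simp only [hg]
    ring
  · simp [h0]
  · simp [h0]

/-! ### Wronskians, monodromy and intertwining operators -/

namespace IsSol

variable {q u u' v v' w w' : ℝ → ℝ}

theorem const_mul (a : ℝ) (hu : IsSol q u u') : IsSol q (fun x => a * u x) fun x => a * u' x :=
  ⟨fun x => (hu.1 x).const_mul a, fun x => by
    convert! (hu.2 x).const_mul a using 1; ring⟩

theorem sub (hu : IsSol q u u') (hv : IsSol q v v') :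
    IsSol q (fun x => u x - v x) fun x => u' x - v' x :=
  ⟨fun x => (hu.1 x).sub (hv.1 x), fun x => by
    convert! (hu.2 x).sub (hv.2 x) using 1; ring⟩

theorem shift {L : ℝ} (hq : q.Periodic L) (hu : IsSol q u u') :
    IsSol q (fun x => u (x + L)) fun x => u' (x + L) :=
  ⟨fun x => (hu.1 (x + L)).comp_add_const x L, fun x => by
    rw [← hq x]; exact (hu.2 (x + L)).comp_add_const x L⟩

theorem continuous (hu : IsSol q u u') : Continuous u :=
  continuous_iff_continuousAt.2 fun x => (hu.1 x).continuousAt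

theorem deriv_periodic {L : ℝ} (hu : IsSol q u u') (hp : u.Periodic L) : u'.Periodic L := by
  intro x
  have h := (hu.1 (x + L)).comp_add_const x L
  simp only [hp _] at h
  exact h.unique (hu.1 x)

/-- The derivative of the Wronskian of solutions of two equations. -/
theorem hasDerivAt_wronskian {p : ℝ → ℝ} (hu : IsSol q u u') (hv : IsSol p v v') (x : ℝ) :
    HasDerivAt (fun x => u x * v' x - u' x * v x) ((p x - q x) * (u x * v x)) x := by
  convert! ((hu.1 x).mul (hv.2 x)).sub ((hu.2 x).mul (hv.1 x)) using 1
  ring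

/-- The Wronskian of two solutions is constant. -/
theorem wronskian_eq (hu : IsSol q u u') (hv : IsSol q v v') (x y : ℝ) :
    u x * v' x - u' x * v x = u y * v' y - u' y * v y := by
  refine is_const_of_deriv_eq_zero (f := fun x => u x * v' x - u' x * v x)
    (fun x => (hu.hasDerivAt_wronskian hv x).differentiableAt) (fun x => ?_) x y
  rw [(hu.hasDerivAt_wronskian hv x).deriv, sub_self, zero_mul]

/-- Two solutions with nonzero Wronskian span all solutions. -/
theorem eq_combination (hu : IsSol q u u') (hv : IsSol q v v') (hw : IsSol q w w') {x₀ : ℝ}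
    (h : u x₀ * v' x₀ - u' x₀ * v x₀ ≠ 0) :
    ∃ a b : ℝ, (∀ x, w x = a * u x + b * v x) ∧ ∀ x, w' x = a * u' x + b * v' x := by
  -- Cramer's rule at `x₀`; it persists at every `x` because all three Wronskians are constant.
  refine ⟨(w x₀ * v' x₀ - w' x₀ * v x₀) / (u x₀ * v' x₀ - u' x₀ * v x₀),
    (u x₀ * w' x₀ - u' x₀ * w x₀) / (u x₀ * v' x₀ - u' x₀ * v x₀), fun x => ?_, fun x => ?_⟩
  all_goals
    have h1 := hu.wronskian_eq hv x x₀
    have h2 := hw.wronskian_eq hv x x₀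
    have h3 := hu.wronskian_eq hw x x₀
    rw [div_mul_eq_mul_div, div_mul_eq_mul_div, ← add_div, eq_div_iff h, ← h1, ← h2, ← h3]
    ring

/-- For every nonzero solution there is a solution with nonzero Wronskian. -/
theorem exists_wronskian_ne_zero (hq : Continuous q) {Q : ℝ} (hQ : ∀ x, |q x| ≤ Q)
    (hx : ∃ x, u x ≠ 0) :
    ∃ v v' : ℝ → ℝ, ∃ x₀, IsSol q v v' ∧ u x₀ * v' x₀ - u' x₀ * v x₀ ≠ 0 := by
  obtain ⟨x₀, hx₀⟩ := hx
  obtain ⟨v, v', hv, h0, h1⟩ := exists_isSol hq hQ x₀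
  exact ⟨v, v', x₀, hv, by simpa [h0, h1] using hx₀⟩

/-- A solution whose Wronskian with a nonzero solution `u` vanishes is a multiple of `u`. -/
theorem eq_mul_of_wronskian_eq_zero (hq : Continuous q) {Q : ℝ} (hQ : ∀ x, |q x| ≤ Q)
    (hu : IsSol q u u') (hx : ∃ x, u x ≠ 0) (hw : IsSol q w w') {x₁ : ℝ}
    (h : u x₁ * w' x₁ - u' x₁ * w x₁ = 0) :
    ∃ a : ℝ, (∀ x, w x = a * u x) ∧ ∀ x, w' x = a * u' x := by
  obtain ⟨v, v', x₀, hv, hne⟩ := exists_wronskian_ne_zero (u' := u') hq hQ hx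
  obtain ⟨a, b, h1, h2⟩ := hu.eq_combination hv hw hne
  have hb : b * (u x₀ * v' x₀ - u' x₀ * v x₀) = 0 := by
    rw [← hu.wronskian_eq hv x₁ x₀, ← h, h1, h2]; ring
  have hb0 : b = 0 := (mul_eq_zero.1 hb).resolve_right hne
  exact ⟨a, fun x => by simp [h1, hb0], fun x => by simp [h2, hb0]⟩

/-- If a nonzero antiperiodic solution exists, there is no nonzero periodic one. -/
theorem eq_zero_of_antiperiodic {L : ℝ} (hq : Continuous q) {Q : ℝ} (hQ : ∀ x, |q x| ≤ Q)
    (hu : IsSol q u u') (hx : ∃ x, u x ≠ 0) (hua : ∀ x, u (x + L) = -u x)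
    (hw : IsSol q w w') (hwp : w.Periodic L) (x : ℝ) : w x = 0 := by
  have hua' : ∀ x, u' (x + L) = -u' x := by
    intro x
    have h := (hu.1 (x + L)).comp_add_const x L
    simp only [hua] at h
    exact h.unique (hu.1 x).neg
  -- A shift by `L` changes the sign of this constant Wronskian, so it is zero. Then `w` is a
  -- multiple of `u`, both periodic and antiperiodic.
  have hW := hu.wronskian_eq hw (0 + L) 0
  rw [hua, hua', hwp, hw.deriv_periodic hwp] at hW
  obtain ⟨a, h1, -⟩ := hu.eq_mul_of_wronskian_eq_zero hq hQ hx hw (x₁ := 0) (by linarith)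
  have h2 := hwp x
  rw [h1, h1, hua] at h2
  rw [h1]; linarith

/-- The effect of a first order operator intertwining solutions of `y'' = q y`. -/
theorem intertwine {q₁ F F₁ F₂ F₃ : ℝ → ℝ} (hq : ∀ x, HasDerivAt q (q₁ x) x)
    (hF : ∀ x, HasDerivAt F (F₁ x) x) (hF₁ : ∀ x, HasDerivAt F₁ (F₂ x) x)
    (hF₂ : ∀ x, HasDerivAt F₂ (F₃ x) x) (hF₃ : ∀ x, F₃ x = 4 * q x * F₁ x + 2 * q₁ x * F x)
    (hu : IsSol q u u') :
    IsSol q (fun x => F x * u' x - F₁ x / 2 * u x)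
      (fun x => (F x * q x - F₂ x / 2) * u x + F₁ x / 2 * u' x) := by
  refine ⟨fun x => ?_, fun x => ?_⟩
  · convert! ((hF x).mul (hu.2 x)).sub (((hF₁ x).div_const 2).mul (hu.1 x)) using 1
    ring
  · convert! ((((hF x).mul (hq x)).sub ((hF₂ x).div_const 2)).mul (hu.1 x)).add
      (((hF₁ x).div_const 2).mul (hu.2 x)) using 1
    simp only [Pi.mul_apply, Pi.sub_apply]
    rw [hF₃]
    ring

/-- If a periodic solution `F` of `F''' = 4 q F' + 2 q' F` has nonzero first integral, then as soon
as one nonzero solution of `y'' = q y` is periodic all of them are. -/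
theorem periodic_of_intertwine {L : ℝ} {q₁ F F₁ F₂ F₃ : ℝ → ℝ} (hqp : q.Periodic L) {Q : ℝ}
    (hQ : ∀ x, |q x| ≤ Q) (hq : ∀ x, HasDerivAt q (q₁ x) x)
    (hF : ∀ x, HasDerivAt F (F₁ x) x) (hF₁ : ∀ x, HasDerivAt F₁ (F₂ x) x)
    (hF₂ : ∀ x, HasDerivAt F₂ (F₃ x) x) (hF₃ : ∀ x, F₃ x = 4 * q x * F₁ x + 2 * q₁ x * F x)
    (hFp : F.Periodic L) (hF₁p : F₁.Periodic L) (hF₂p : F₂.Periodic L) {x₀ : ℝ}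
    (hR : F x₀ * F₂ x₀ / 2 - F₁ x₀ ^ 2 / 4 - q x₀ * F x₀ ^ 2 ≠ 0)
    (hu : IsSol q u u') (hx : ∃ x, u x ≠ 0) (hup : u.Periodic L) (hw : IsSol q w w') :
    w.Periodic L := by
  have hqc : Continuous q := continuous_iff_continuousAt.2 fun x => (hq x).continuousAt
  obtain ⟨g, g', x₁, hg, hne⟩ := exists_wronskian_ne_zero (u' := u') hqc hQ hx
  suffices hgp : g.Periodic L by
    obtain ⟨a, b, h1, -⟩ := hu.eq_combination hg hw hne
    intro x
    rw [h1, h1, hup, hgp]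
  have hup' := hu.deriv_periodic hup
  have hTu := hu.intertwine hq hF hF₁ hF₂ hF₃
  have hTg := hg.intertwine hq hF hF₁ hF₂ hF₃
  have hh := (hg.shift hqp).sub hg
  have hW0 := hu.wronskian_eq hg (x₀ + L) x₀
  rw [hup, hup'] at hW0
  -- The Wronskian of `u` with `g(· + L) - g` vanishes, so the monodromy is `g ↦ g + b u`: a Jordan
  -- block with eigenvalue one, trivial exactly when `b = 0`.
  obtain ⟨b, hb, hb'⟩ := hu.eq_mul_of_wronskian_eq_zero hqc hQ hx hh (x₁ := x₀) (by linarith)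
  have hb1 : ∀ x, g (x + L) = g x + b * u x := fun x => by linarith [hb x]
  have hb2 : ∀ x, g' (x + L) = g' x + b * u' x := fun x => by linarith [hb' x]
  suffices b = 0 by
    intro x
    rw [hb1, this, zero_mul, add_zero]
  by_contra hb0
  -- otherwise the Wronskians of `u`, `g` with the image of `u` vanish
  have hTuP : Function.Periodic (fun x => F x * u' x - F₁ x / 2 * u x) L := fun x => by
    simp only [hFp x, hF₁p x, hup x, hup' x]
  have e0 := hu.wronskian_eq hg x₁ x₀
  rw [e0] at hne
  -- Write `Q(v, w)` for the Wronskian of `v` with `T w`, where `T = F d/dx - F₁/2`; this form is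
  -- symmetric. Here `Q(u, u) = 0`: otherwise the periodic functions `u` and `T u` would span all
  -- solutions, including `g`.
  have e1 : u x₀ * ((F x₀ * q x₀ - F₂ x₀ / 2) * u x₀ + F₁ x₀ / 2 * u' x₀)
      - u' x₀ * (F x₀ * u' x₀ - F₁ x₀ / 2 * u x₀) = 0 := by
    by_contra hne'
    obtain ⟨a, c, h1, -⟩ := hu.eq_combination hTu hg hne'
    obtain ⟨x, hx⟩ := hx
    have h3 := hb1 x
    have h4 := hTuP x
    dsimp only at h4
    rw [h1, h1 x, h4, hup x] at h3
    exact hb0 ((mul_eq_zero.1 (by linarith : b * u x = 0)).resolve_right hx)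
  -- Shifting by `L` replaces `g` by `g + b u` in `Q(g, g)`. Invariance gives `2 b Q(u, g) + b² Q(u,
  -- u) = 0`, hence `Q(u, g) = 0`.
  have e2 := hg.wronskian_eq hTg (x₀ + L) x₀
  have e3 := hqp x₀
  have e4 := hFp x₀
  have e5 := hF₁p x₀
  have e6 := hF₂p x₀
  simp only [e3, e4, e5, e6, hb1, hb2] at e2
  have e7 : b * (u x₀ * ((F x₀ * q x₀ - F₂ x₀ / 2) * g x₀ + F₁ x₀ / 2 * g' x₀)
      - u' x₀ * (F x₀ * g' x₀ - F₁ x₀ / 2 * g x₀)) = 0 := by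
    linear_combination e2 / 2 - b ^ 2 / 2 * e1
  have e8 := (mul_eq_zero.1 e7).resolve_left hb0
  -- Gram determinant: `Q(u, u) Q(g, g) - Q(u, g)²` equals the first integral times the squared
  -- Wronskian of `u` and `g`.
  have e9 : (F x₀ * F₂ x₀ / 2 - F₁ x₀ ^ 2 / 4 - q x₀ * F x₀ ^ 2) *
      (u x₀ * g' x₀ - u' x₀ * g x₀) ^ 2 = 0 := by
    linear_combination (g x₀ * ((F x₀ * q x₀ - F₂ x₀ / 2) * g x₀ + F₁ x₀ / 2 * g' x₀)
      - g' x₀ * (F x₀ * g' x₀ - F₁ x₀ / 2 * g x₀)) * e1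
      - (u x₀ * ((F x₀ * q x₀ - F₂ x₀ / 2) * g x₀ + F₁ x₀ / 2 * g' x₀)
      - u' x₀ * (F x₀ * g' x₀ - F₁ x₀ / 2 * g x₀)) * e8
  exact (mul_ne_zero hR (pow_ne_zero 2 hne)) e9

end IsSol

/-! ## Comparison of solutions -/

theorem sign_eventually_of_hasDerivAt_pos {f : ℝ → ℝ} {d z : ℝ} (h : HasDerivAt f d z)
    (hd : 0 < d) (hz : f z = 0) : ∀ᶠ x in 𝓝 z, SignType.sign (f x) = SignType.sign (x - z) :=
  eventually_nhdsWithin_sign_eq_of_deriv_pos (h.deriv.symm ▸ hd) hz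

/-- A function that vanishes at `a`, is increasing there and nonpositive at `c > a`,
has a first zero in `(a, c]`. -/
theorem exists_first_zero {f f' : ℝ → ℝ} (hf : ∀ x, HasDerivAt f (f' x) x) {a c : ℝ} (hac : a < c)
    (ha : f a = 0) (ha' : 0 < f' a) (hc : f c ≤ 0) :
    ∃ z, a < z ∧ z ≤ c ∧ f z = 0 ∧ f' z ≤ 0 ∧ ∀ x, a < x → x < z → 0 < f x := by
  have hcont : Continuous f := continuous_iff_continuousAt.2 fun x => (hf x).continuousAt
  obtain ⟨d, had, hd⟩ : ∃ d > a, ∀ x, a < x → x < d → 0 < f x := by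
    have h1 := (sign_eventually_of_hasDerivAt_pos (hf a) ha' ha).filter_mono
      (nhdsWithin_le_nhds (s := Set.Ioi a))
    obtain ⟨d, had, hd⟩ := mem_nhdsGT_iff_exists_Ioo_subset.1 h1
    refine ⟨d, had, fun x hx hxd => ?_⟩
    have h2 : SignType.sign (f x) = SignType.sign (x - a) := hd ⟨hx, hxd⟩
    rwa [sign_pos (sub_pos.2 hx), sign_eq_one_iff] at h2
  -- Searching from `e > a` keeps the zero at `a` itself out of the compact set that is minimised
  -- over.
  set e := min ((a + d) / 2) c
  have hae : a < e := lt_min (by linarith [had.lt]) hac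
  have hed : e < d := (min_le_left _ _).trans_lt (by linarith [had.lt])
  obtain ⟨z, ⟨⟨hez, hzc⟩, hz0⟩, hmin⟩ := (isCompact_Icc.inter_right
    (isClosed_le hcont continuous_const) : IsCompact (Set.Icc e c ∩ {x | f x ≤ 0})).exists_isLeast
    ⟨c, ⟨min_le_right _ _, le_rfl⟩, hc⟩
  have hpos : ∀ x, a < x → x < z → 0 < f x := by
    intro x hx hxz
    rcases lt_or_ge x d with h | h
    · exact hd x hx h
    · by_contra hn
      exact absurd (hmin ⟨⟨by linarith, by linarith⟩, not_lt.1 hn⟩) (not_le.2 hxz)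
  have haz : a < z := hae.trans_le hez
  have hz : f z = 0 := by
    refine le_antisymm hz0 ?_
    refine ge_of_tendsto (hcont.continuousAt.tendsto.mono_left
      (nhdsWithin_le_nhds (s := Set.Iio z))) ?_
    filter_upwards [Ioo_mem_nhdsLT haz] with x hx using (hpos x hx.1 hx.2).le
  refine ⟨z, haz, hzc, hz, ?_, hpos⟩
  by_contra hn
  have h1 := (sign_eventually_of_hasDerivAt_pos (hf z) (not_le.1 hn) hz).filter_mono
    (nhdsWithin_le_nhds (s := Set.Iio z))
  obtain ⟨x, hx, hx'⟩ := (h1.and (Ioo_mem_nhdsLT haz)).exists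
  rw [sign_pos (hpos x hx'.1 hx'.2), sign_neg (sub_neg.2 hx'.2)] at hx
  exact absurd hx (by decide)

/-! ### Sturm comparison, interlacing and comparison with a positive solution -/

namespace IsSol

variable {p q f f' y y' : ℝ → ℝ}

/-- Sturm comparison: if `p < q`, solutions of `f'' = q f` oscillate less than those of
`y'' = p y`. -/
theorem pos_of_comparison (hf : IsSol q f f') (hy : IsSol p y y') (hpq : ∀ x, p x < q x)
    {a b : ℝ} (ha : f a = 0) (ha' : 0 < f' a) (hya : y a = 0)
    (hypos : ∀ x, a < x → x < b → 0 < y x) (hyb : 0 ≤ y b) {x : ℝ} (hax : a < x) (hxb : x ≤ b) :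
    0 < f x := by
  by_contra hn
  obtain ⟨z, haz, hzx, hz, hz', hfpos⟩ := exists_first_zero hf.1 hax ha ha' (not_lt.1 hn)
  -- Up to the first zero `z` of `f` the Wronskian decreases strictly from `0`. At `z` it equals
  -- `-f'(z) y(z)`, which is nonnegative.
  have hW : StrictAntiOn (fun x => f x * y' x - f' x * y x) (Set.Icc a z) := by
    refine strictAntiOn_of_deriv_neg (convex_Icc a z) (fun t _ =>
      (hf.hasDerivAt_wronskian hy t).continuousAt.continuousWithinAt) fun t ht => ?_
    rw [interior_Icc] at ht
    rw [(hf.hasDerivAt_wronskian hy t).deriv]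
    exact mul_neg_of_neg_of_pos (sub_neg.2 (hpq t))
      (mul_pos (hfpos t ht.1 ht.2) (hypos t ht.1 (by linarith [ht.2])))
  have h1 := hW ⟨le_rfl, haz.le⟩ ⟨haz.le, le_rfl⟩ haz
  simp only [ha, hya, hz, zero_mul, mul_zero, zero_sub, sub_zero, Left.neg_neg_iff] at h1
  have hyz : 0 ≤ y z := by
    rcases (hzx.trans hxb).lt_or_eq with h | h
    · exact (hypos z haz h).le
    · rwa [h]
  nlinarith

theorem reflect (hf : IsSol q f f') :
    IsSol (fun x => q (-x)) (fun x => -f (-x)) fun x => f' (-x) := by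
  refine ⟨fun x => ?_, fun x => ?_⟩
  · convert! ((hf.1 (-x)).scomp x (hasDerivAt_neg x)).neg using 1
    simp
  · convert! (hf.2 (-x)).scomp x (hasDerivAt_neg x) using 1
    simp

/-- A solution of `f'' = q f` vanishing together with the solution `y` of `y'' = p y`, `p < q`, at
the middle one of three consecutive zeros of `y` cannot be periodic. -/
theorem not_periodic_of_comparison {L : ℝ} (hf : IsSol q f f') (hy : IsSol p y y')
    (hpq : ∀ x, p x < q x) {a b : ℝ} (ha : f a = 0) (ha' : 0 < f' a) (hab : a < b) (hbL : b - L < a)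
    (hya : y a = 0) (hyb : y b = 0) (hybL : y (b - L) = 0)
    (hpos : ∀ x, a < x → x < b → 0 < y x) (hneg : ∀ x, b - L < x → x < a → y x < 0) :
    ¬ f.Periodic L := by
  intro hp
  -- Comparing to the right of `a` gives `f b > 0`, and comparing to the left, by reflection, gives
  -- `f (b - L) < 0`.
  have h1 := hf.pos_of_comparison hy hpq ha ha' hya hpos hyb.ge hab le_rfl
  have h2 := hf.reflect.pos_of_comparison hy.reflect (a := -a) (b := -(b - L))
    (fun x => hpq (-x)) (by simp [ha]) (by simpa using ha') (by simp [hya])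
    (fun x h h' => neg_pos.2 (hneg (-x) (by linarith) (by linarith)))
    (by rw [neg_neg, hybL, neg_zero]) (x := -(b - L)) (by linarith) le_rfl
  simp only [neg_neg] at h2
  have h3 := hp (b - L)
  rw [sub_add_cancel] at h3
  linarith

/-- Solutions of the same equation with nonzero Wronskian have interlacing zeros. -/
theorem exists_zero_between (hf : IsSol q f f') (hy : IsSol q y y') {x₀ : ℝ}
    (hW : f x₀ * y' x₀ - f' x₀ * y x₀ ≠ 0) {a b : ℝ} (hab : a < b) (ha : f a = 0) (hb : f b = 0) :
    ∃ x, a ≤ x ∧ x ≤ b ∧ y x = 0 := by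
  by_contra! hn
  -- Rolle's theorem for `f / y`: its derivative is, up to sign, the constant nonzero Wronskian over
  -- `y²`.
  have hd : ∀ x ∈ Set.Icc a b, HasDerivAt (fun x => f x / y x)
      ((f' x * y x - f x * y' x) / y x ^ 2) x := fun x hx =>
    (hf.1 x).div (hy.1 x) (hn x hx.1 hx.2)
  obtain ⟨c, hc, h0⟩ := exists_hasDerivAt_eq_zero hab
    (fun x hx => (hd x hx).continuousAt.continuousWithinAt) (by simp [ha, hb])
    fun x hx => hd x (Set.Ioo_subset_Icc_self hx)
  rw [div_eq_zero_iff, or_iff_left (pow_ne_zero 2 (hn c hc.1.le hc.2.le))] at h0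
  rw [hf.wronskian_eq hy x₀ c] at hW
  exact hW (by linarith)

/-- The solution `f`, `f 0 = 0`, of `f'' = p f` cannot be periodic if this equation has a solution
`y` with a single sign change in the half period and if `u'' = q u`, `p < q`, has a solution `u`
that vanishes precisely at the multiples of the half period. -/
theorem not_periodic_of_interlacing {L x₀ : ℝ} {u u' : ℝ → ℝ} (hf : IsSol p f f')
    (hy : IsSol p y y') (hu : IsSol q u u') (hpq : ∀ x, p x < q x) (hL : 0 < L)
    (hf0 : f 0 = 0) (hf0' : 0 < f' 0) (hu0 : u 0 = 0) (hu0' : 0 < u' 0) (hu1 : u (L / 2) = 0)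
    (hu2 : u (-(L / 2)) = 0)
    (hy1 : ∀ x, -x₀ < x → x < x₀ → y x ≠ 0) (hy2 : ∀ x, x₀ < x → x < L - x₀ → y x ≠ 0)
    (hx₀ : 0 < x₀) (hx₀' : y x₀ = 0) (hx₀'' : y (-x₀) = 0) :
    ¬ f.Periodic L := by
  intro hp
  have hW : f 0 * y' 0 - f' 0 * y 0 ≠ 0 := by
    rw [hf0, zero_mul, zero_sub, neg_ne_zero]
    exact mul_ne_zero hf0'.ne' (hy1 0 (by linarith) hx₀)
  have hne : ∀ x, y x = 0 → f x ≠ 0 := by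
    intro x h1 h2
    rw [hf.wronskian_eq hy 0 x, h1, h2] at hW
    simp at hW
  -- The solution `f` oscillates strictly more than `u`, so it vanishes before the zero `L / 2` of
  -- `u`. The same holds on the left below.
  obtain ⟨z, hz0, hzL, hz⟩ : ∃ z, 0 < z ∧ z < L / 2 ∧ f z = 0 := by
    by_contra! hn
    have hpos : ∀ x, 0 < x → x < L / 2 → 0 < f x := by
      intro x h0 h1
      by_contra h2
      obtain ⟨z, hz0, hzx, hz, -⟩ := exists_first_zero hf.1 h0 hf0 hf0' (not_lt.1 h2)
      exact hn z hz0 (by linarith) hz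
    have hge : 0 ≤ f (L / 2) := by
      refine ge_of_tendsto (hf.continuous.continuousAt.tendsto.mono_left
        (nhdsWithin_le_nhds (s := Set.Iio (L / 2)))) ?_
      filter_upwards [Ioo_mem_nhdsLT (half_pos hL)] with x hx using (hpos x hx.1 hx.2).le
    exact (hu.pos_of_comparison hf hpq hu0 hu0' hf0 hpos hge (half_pos hL) le_rfl).ne' hu1
  obtain ⟨z', hz0', hzL', hz'⟩ : ∃ z, z < 0 ∧ -(L / 2) < z ∧ f z = 0 := by
    by_contra! hn
    have hpos : ∀ x, 0 < x → x < L / 2 → 0 < -f (-x) := by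
      intro x h0 h1
      by_contra h2
      obtain ⟨z, hz0, hzx, hz, -⟩ := exists_first_zero hf.reflect.1 h0 (by simp [hf0])
        (by simpa using hf0') (not_lt.1 h2)
      exact hn (-z) (by linarith) (by linarith) (neg_eq_zero.1 hz)
    have hge : 0 ≤ -f (-(L / 2)) := by
      refine ge_of_tendsto (hf.reflect.continuous.continuousAt.tendsto.mono_left
        (nhdsWithin_le_nhds (s := Set.Iio (L / 2)))) ?_
      filter_upwards [Ioo_mem_nhdsLT (half_pos hL)] with x hx using (hpos x hx.1 hx.2).le
    have h := hu.reflect.pos_of_comparison hf.reflect (fun x => hpq (-x)) (by simp [hu0])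
      (by simpa using hu0') (by simp [hf0]) hpos hge (half_pos hL) le_rfl
    simp [hu2] at h
  -- Interlacing puts a zero of `y` in `[0, z]`. None lies in `[0, x₀)`, and `f` and `y` have no
  -- common zero.
  have h1 : x₀ < z := by
    obtain ⟨x, hx, hx', h⟩ := hf.exists_zero_between hy hW hz0 hf0 hz
    by_contra hn
    rcases (hx'.trans (not_lt.1 hn)).lt_or_eq with h2 | h2
    · exact hy1 x (by linarith) h2 h
    · have : z = x₀ := by linarith
      exact hne x₀ hx₀' (this ▸ hz)
  have h2 : z' < -x₀ := by
    obtain ⟨x, hx, hx', h⟩ := hf.exists_zero_between hy hW hz0' hz' hf0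
    by_contra hn
    rcases ((not_lt.1 hn).trans hx).lt_or_eq with h2 | h2
    · exact hy1 x h2 (by linarith) h
    · have : z' = -x₀ := by linarith
      exact hne (-x₀) hx₀'' (this ▸ hz')
  -- If `f` were periodic, `z` and `z' + L` would both be zeros of `f` in `(x₀, L - x₀)`.
  -- Interlacing would then place a zero of `y` there.
  obtain ⟨x, hx, hx', h⟩ := hf.exists_zero_between hy hW (a := z) (b := z' + L) (by linarith) hz
    (by rw [hp, hz'])
  exact hy2 x (by linarith) (by linarith) h

/-- Comparison of periodic solutions of `f'' = (V - a) f`, `a ≤ 0`, with a positive periodic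
solution of `φ'' = V φ`. -/
theorem wronskian_eq_zero_of_pos {V φ φ' : ℝ → ℝ} {L a : ℝ} (hL : 0 < L) (hφ : IsSol V φ φ')
    (hφp : φ.Periodic L) (hpos : ∀ x, 0 < φ x) (hf : IsSol (fun x => V x - a) f f')
    (hfp : f.Periodic L) (ha : a ≤ 0) (x : ℝ) :
    φ x * f' x - φ' x * f x = 0 ∧ a * f x ^ 2 = 0 := by
  have hφp' := hφ.deriv_periodic hφp
  have hfp' := hf.deriv_periodic hfp
  -- With `W = φ f' - φ' f` one has `W' = -a φ f`, so `(f W / φ)' = W² / φ² - a f²`. For `a ≤ 0` the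
  -- function `f W / φ` is monotone and periodic, hence constant, and both terms vanish.
  have hU : ∀ x, HasDerivAt (fun x => f x * (φ x * f' x - φ' x * f x) / φ x)
      ((φ x * f' x - φ' x * f x) ^ 2 / φ x ^ 2 - a * f x ^ 2) x := by
    intro x
    have hne := (hpos x).ne'
    convert! ((hf.1 x).mul (hφ.hasDerivAt_wronskian hf x)).div (hφ.1 x) hne using 1
    simp only [Pi.mul_apply]
    field_simp
    ring
  have hnn : ∀ x, 0 ≤ (φ x * f' x - φ' x * f x) ^ 2 / φ x ^ 2 - a * f x ^ 2 := fun x => by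
    have := mul_nonneg (neg_nonneg.2 ha) (sq_nonneg (f x))
    have h2 : 0 ≤ (φ x * f' x - φ' x * f x) ^ 2 / φ x ^ 2 := by positivity
    linarith
  have hmono := monotone_of_hasDerivAt_nonneg hU hnn
  have hper : ∀ x, f (x + L) * (φ (x + L) * f' (x + L) - φ' (x + L) * f (x + L)) / φ (x + L) =
      f x * (φ x * f' x - φ' x * f x) / φ x := fun x => by
    rw [hφp, hφp', hfp, hfp']
  have h0 : (φ x * f' x - φ' x * f x) ^ 2 / φ x ^ 2 - a * f x ^ 2 = 0 := by
    refine (hU x).unique (HasDerivAt.congr_of_eventuallyEq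
      (hasDerivAt_const x (f x * (φ x * f' x - φ' x * f x) / φ x)) ?_)
    filter_upwards [Ioo_mem_nhds (sub_lt_self x hL) (lt_add_of_pos_right x hL)] with t ht
    have h1 := hper (x - L)
    have h2 := hper x
    rw [sub_add_cancel] at h1
    rcases le_total t x with h | h
    · refine le_antisymm (hmono h) ?_
      have h3 := hmono ht.1.le
      dsimp only at h3
      rwa [← h1] at h3
    · refine le_antisymm ?_ (hmono h)
      have h3 := hmono ht.2.le
      dsimp only at h3
      rwa [h2] at h3
  have h1 := mul_nonneg (neg_nonneg.2 ha) (sq_nonneg (f x))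
  have h2 : 0 ≤ (φ x * f' x - φ' x * f x) ^ 2 / φ x ^ 2 := by positivity
  have h3 : (φ x * f' x - φ' x * f x) ^ 2 / φ x ^ 2 = 0 := by linarith
  refine ⟨?_, by linarith⟩
  rw [div_eq_zero_iff, or_iff_left (pow_ne_zero 2 (hpos x).ne')] at h3
  exact pow_eq_zero_iff two_ne_zero |>.1 h3

end IsSol

/-! ## Jacobi elliptic functions -/

section Jacobi

variable {k : ℝ}

theorem ellipticF_zero (k : ℝ) : ellipticF 0 k = 0 := by simp [ellipticF]

theorem ellipticF_strictMono (hk : k ^ 2 < 1) : StrictMono fun θ => ellipticF θ k :=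
  strictMono_of_hasDerivAt_pos (ellipticF_hasDerivAt hk) fun θ =>
    one_div_pos.2 (Real.sqrt_pos.2 (ellipticF_integrand_pos hk θ))

theorem ellipticF_neg (k θ : ℝ) : ellipticF (-θ) k = -ellipticF θ k := by
  have h := intervalIntegral.integral_comp_neg (a := 0) (b := θ)
    (fun t : ℝ => 1 / √(1 - k ^ 2 * Real.sin t ^ 2))
  simp only [Real.sin_neg, neg_sq, neg_zero] at h
  rw [ellipticF, ellipticF, intervalIntegral.integral_symm, h]

theorem ellipticF_add_pi (hk : k ^ 2 < 1) (θ : ℝ) :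
    ellipticF (θ + Real.pi) k = ellipticF θ k + 2 * ellipticK k := by
  have hd : ∀ θ, HasDerivAt (fun θ => ellipticF (θ + Real.pi) k - ellipticF θ k) 0 θ := by
    intro θ
    convert! ((ellipticF_hasDerivAt hk (θ + Real.pi)).comp_add_const θ Real.pi).sub
      (ellipticF_hasDerivAt hk θ) using 1
    rw [Real.sin_add_pi, neg_sq, sub_self]
  have h := is_const_of_deriv_eq_zero (fun θ => (hd θ).differentiableAt)
    (fun θ => (hd θ).deriv) θ (-(Real.pi / 2))
  have e : -(Real.pi / 2) + Real.pi = Real.pi / 2 := by ring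
  rw [e, ellipticF_neg] at h
  rw [ellipticK]
  linarith

theorem ellipticF_jacobiAm (hk : k ^ 2 < 1) (u : ℝ) : ellipticF (jacobiAm u k) k = u :=
  Function.rightInverse_invFun (ellipticF_bijective hk).2 u

theorem jacobiAm_ellipticF (hk : k ^ 2 < 1) (θ : ℝ) : jacobiAm (ellipticF θ k) k = θ :=
  Function.leftInverse_invFun (ellipticF_bijective hk).1 θ

theorem jacobiAm_strictMono (hk : k ^ 2 < 1) : StrictMono fun u => jacobiAm u k := by
  intro u v huv
  by_contra hn
  have h := (ellipticF_strictMono hk).monotone (not_lt.1 hn)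
  simp only [ellipticF_jacobiAm hk] at h
  exact absurd huv (not_lt.2 h)

theorem jacobiAm_continuous (hk : k ^ 2 < 1) : Continuous fun u => jacobiAm u k :=
  (jacobiAm_strictMono hk).monotone.continuous_of_surjective
    fun θ => ⟨ellipticF θ k, jacobiAm_ellipticF hk θ⟩

theorem jacobiAm_hasDerivAt (hk : k ^ 2 < 1) (u : ℝ) :
    HasDerivAt (fun u => jacobiAm u k) (jacobiDn u k) u := by
  have hpos := Real.sqrt_pos.2 (ellipticF_integrand_pos hk (jacobiAm u k))
  have h := HasDerivAt.of_local_left_inverse (jacobiAm_continuous hk).continuousAt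
    (ellipticF_hasDerivAt hk (jacobiAm u k)) (one_div_pos.2 hpos).ne'
    (Eventually.of_forall (ellipticF_jacobiAm hk))
  convert! h using 1
  rw [jacobiDn, jacobiSn, one_div, inv_inv]

theorem jacobiAm_zero (hk : k ^ 2 < 1) : jacobiAm 0 k = 0 := by
  conv_lhs => rw [← ellipticF_zero k]
  exact jacobiAm_ellipticF hk 0

theorem jacobiAm_ellipticK (hk : k ^ 2 < 1) : jacobiAm (ellipticK k) k = Real.pi / 2 :=
  jacobiAm_ellipticF hk _

theorem jacobiAm_neg (hk : k ^ 2 < 1) (u : ℝ) : jacobiAm (-u) k = -jacobiAm u k := by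
  apply (ellipticF_bijective hk).1
  dsimp only
  rw [ellipticF_neg, ellipticF_jacobiAm hk, ellipticF_jacobiAm hk]

theorem jacobiAm_add (hk : k ^ 2 < 1) (u : ℝ) :
    jacobiAm (u + 2 * ellipticK k) k = jacobiAm u k + Real.pi := by
  apply (ellipticF_bijective hk).1
  dsimp only
  rw [ellipticF_add_pi hk, ellipticF_jacobiAm hk, ellipticF_jacobiAm hk]

theorem jacobiDn_sq (hk : k ^ 2 < 1) (u : ℝ) : jacobiDn u k ^ 2 = 1 - k ^ 2 * jacobiSn u k ^ 2 :=
  Real.sq_sqrt (ellipticF_integrand_pos hk _).le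

theorem jacobiDn_pos (hk : k ^ 2 < 1) (u : ℝ) : 0 < jacobiDn u k :=
  Real.sqrt_pos.2 (ellipticF_integrand_pos hk _)

end Jacobi

/-! ### The algebraic and differential properties of sn, cn, dn used below -/

/-- `S`, `C`, `D` behave like `sn(s x; k)`, `cn(s x; k)`, `dn(s x; k)`, with `k² = κ` and
`L = 2 K(k) / s`. -/
structure JacobiTriple (L s κ : ℝ) (S C D : ℝ → ℝ) : Prop where
  pos_L : 0 < L
  pos_s : 0 < s
  pos_κ : 0 < κ
  lt_one : κ < 1
  deriv_S : ∀ x, HasDerivAt S (s * (C x * D x)) x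
  deriv_C : ∀ x, HasDerivAt C (-(s * (S x * D x))) x
  deriv_D : ∀ x, HasDerivAt D (-(s * κ * (S x * C x))) x
  C_sq : ∀ x, C x ^ 2 = 1 - S x ^ 2
  D_sq : ∀ x, D x ^ 2 = 1 - κ * S x ^ 2
  pos_D : ∀ x, 0 < D x
  S_add : ∀ x, S (x + L) = -S x
  C_add : ∀ x, C (x + L) = -C x
  D_add : ∀ x, D (x + L) = D x
  S_zero : S 0 = 0
  C_zero : C 0 = 1
  S_half : S (L / 2) = 1
  S_neg : ∀ x, S (-x) = -S x
  mono_S : StrictMonoOn S (Set.Icc (-(L / 2)) (L / 2))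

theorem jacobiTriple {k s L : ℝ} (hk0 : 0 < k) (hk : k ^ 2 < 1) (hs : 0 < s) (hL0 : 0 < L)
    (hL : s * L = 2 * ellipticK k) :
    JacobiTriple L s (k ^ 2) (fun x => jacobiSn (s * x) k)
      (fun x => Real.cos (jacobiAm (s * x) k)) (fun x => jacobiDn (s * x) k) := by
  have ham : ∀ x, HasDerivAt (fun x => jacobiAm (s * x) k) (s * jacobiDn (s * x) k) x := by
    intro x
    convert! (jacobiAm_hasDerivAt hk (s * x)).comp x ((hasDerivAt_id x).const_mul s) using 1
    simp [mul_comm]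
  have hSd : ∀ x, HasDerivAt (fun x => jacobiSn (s * x) k)
      (s * (Real.cos (jacobiAm (s * x) k) * jacobiDn (s * x) k)) x := by
    intro x
    convert! (ham x).sin using 1
    ring
  have hadd : ∀ x, jacobiAm (s * (x + L)) k = jacobiAm (s * x) k + Real.pi := by
    intro x
    rw [mul_add, hL, jacobiAm_add hk]
  have hhalf : s * (L / 2) = ellipticK k := by linarith
  have hhalf' : s * (-(L / 2)) = -ellipticK k := by linarith
  refine ⟨hL0, hs, by positivity, hk, hSd, fun x => ?_, fun x => ?_, fun x => ?_, fun x => ?_,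
    fun x => jacobiDn_pos hk _, fun x => ?_, fun x => ?_, fun x => ?_, ?_, ?_, ?_, ?_, ?_⟩
  · convert! (ham x).cos using 1
    rw [jacobiSn]; ring
  · have h0 := ellipticF_integrand_pos hk (jacobiAm (s * x) k)
    have h := ((((hSd x).pow 2).const_mul (k ^ 2)).const_sub 1).sqrt h0.ne'
    convert! h using 1
    have hD := (jacobiDn_pos hk (s * x)).ne'
    change _ = _ / (2 * jacobiDn (s * x) k)
    field_simp
    push_cast
    ring
  · rw [jacobiSn, Real.cos_sq']
  · exact jacobiDn_sq hk _
  · rw [jacobiSn, hadd, Real.sin_add_pi, jacobiSn]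
  · rw [hadd, Real.cos_add_pi]
  · rw [jacobiDn, jacobiDn, jacobiSn, hadd, Real.sin_add_pi, neg_sq, jacobiSn]
  · simp [jacobiSn, jacobiAm_zero hk]
  · simp [jacobiAm_zero hk]
  · simp [jacobiSn, hhalf, jacobiAm_ellipticK hk]
  · intro x
    simp [jacobiSn, jacobiAm_neg hk]
  · intro x hx y hy hxy
    have hmem : ∀ z ∈ Set.Icc (-(L / 2)) (L / 2),
        jacobiAm (s * z) k ∈ Set.Icc (-(Real.pi / 2)) (Real.pi / 2) := by
      intro z hz
      rw [← jacobiAm_ellipticK hk, ← jacobiAm_neg hk, ← hhalf', ← hhalf]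
      exact ⟨(jacobiAm_strictMono hk).monotone (mul_le_mul_of_nonneg_left hz.1 hs.le),
        (jacobiAm_strictMono hk).monotone (mul_le_mul_of_nonneg_left hz.2 hs.le)⟩
    exact Real.strictMonoOn_sin (hmem x hx) (hmem y hy)
      (jacobiAm_strictMono hk (mul_lt_mul_of_pos_left hxy hs))

namespace JacobiTriple

variable {L s κ : ℝ} {S C D : ℝ → ℝ}

/-- The zeros of `1 - a sn²`. -/
theorem exists_zero (h : JacobiTriple L s κ S C D) {a : ℝ} (ha : 1 < a) :
    ∃ x₀, 0 < x₀ ∧ x₀ < L / 2 ∧ 1 - a * S x₀ ^ 2 = 0 ∧ 1 - a * S (-x₀) ^ 2 = 0 ∧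
      (∀ x, -x₀ < x → x < x₀ → 0 < 1 - a * S x ^ 2) ∧
      (∀ x, x₀ < x → x < L - x₀ → 1 - a * S x ^ 2 < 0) := by
  have hL := h.pos_L
  have hcont : Continuous S := continuous_iff_continuousAt.2 fun x => (h.deriv_S x).continuousAt
  have hsa : 1 < √a := by rw [Real.lt_sqrt zero_le_one]; simpa using ha
  have hr0 : 0 < 1 / √a := by positivity
  have hr1 : 1 / √a < 1 := by rw [div_lt_one (by positivity)]; exact hsa
  have hra : (1 / √a) ^ 2 * a = 1 := by
    rw [div_pow, Real.sq_sqrt (by linarith), one_pow, one_div, inv_mul_cancel₀ (by linarith)]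
  have key : ∀ x, 1 - a * S x ^ 2 = a * ((1 / √a) ^ 2 - S x ^ 2) := fun x => by
    linear_combination -hra
  -- The zero is where `S` reaches `1 / √a`, on its increasing branch from `0` to `1`.
  obtain ⟨x₀, ⟨hx1, hx2⟩, hx0⟩ : 1 / √a ∈ S '' Set.Icc 0 (L / 2) :=
    intermediate_value_Icc (by linarith) hcont.continuousOn
      ⟨by rw [h.S_zero]; exact hr0.le, by rw [h.S_half]; exact hr1.le⟩
  have hin : ∀ x, -x₀ < x → x < x₀ → 0 < 1 - a * S x ^ 2 := by
    intro x h1 h2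
    have h3 := h.mono_S ⟨by linarith, by linarith⟩ ⟨by linarith, hx2⟩ h2
    have h4 := h.mono_S (a := -x₀) (b := x) ⟨by linarith, by linarith⟩
      ⟨by linarith, by linarith⟩ h1
    rw [h.S_neg] at h4
    rw [key, ← hx0]
    exact mul_pos (by linarith) (sub_pos.2 (sq_lt_sq' h4 h3))
  have hout : ∀ x, x₀ < x → x ≤ L / 2 → 1 - a * S x ^ 2 < 0 := by
    intro x h1 h2
    have h3 := h.mono_S ⟨by linarith, by linarith⟩ ⟨by linarith, h2⟩ h1
    rw [key, ← hx0]
    rw [hx0] at h3 ⊢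
    exact mul_neg_of_pos_of_neg (by linarith) (sub_neg.2 (pow_lt_pow_left₀ h3 hr0.le two_ne_zero))
  have hx1' : 0 < x₀ := by
    refine lt_of_le_of_ne hx1 fun h0 => ?_
    rw [← h0, h.S_zero] at hx0
    exact hr0.ne hx0
  have hx2' : x₀ < L / 2 := by
    refine lt_of_le_of_ne hx2 fun h0 => ?_
    rw [h0, h.S_half] at hx0
    exact hr1.ne' hx0
  refine ⟨x₀, hx1', hx2', by rw [key, hx0]; ring, by rw [key, h.S_neg, hx0]; ring, hin,
    fun x h1 h2 => ?_⟩
  rcases le_total x (L / 2) with h3 | h3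
  · exact hout x h1 h3
  · have e : S x ^ 2 = S (L - x) ^ 2 := by
      have : S (L - x) = S x := by
        rw [show L - x = -x + L by ring, h.S_add, h.S_neg, neg_neg]
      rw [this]
    rw [e]
    exact hout _ (by linarith) (by linarith)

end JacobiTriple

/-! ## Lamé equations -/

/-- The Lamé potential `s² (6 κ S² - m)`. -/
def lameQ (s κ : ℝ) (S : ℝ → ℝ) (m x : ℝ) : ℝ := s ^ 2 * (6 * κ * S x ^ 2 - m)

namespace JacobiTriple

variable {L s κ m : ℝ} {S C D : ℝ → ℝ}

theorem S_sq_le_one (h : JacobiTriple L s κ S C D) (x : ℝ) : S x ^ 2 ≤ 1 := by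
  nlinarith [h.C_sq x, sq_nonneg (C x)]

theorem S_sq_periodic (h : JacobiTriple L s κ S C D) (x : ℝ) : S (x + L) ^ 2 = S x ^ 2 := by
  rw [h.S_add, neg_sq]

theorem lameQ_periodic (h : JacobiTriple L s κ S C D) (m : ℝ) : (lameQ s κ S m).Periodic L :=
  fun x => by rw [lameQ, lameQ, h.S_sq_periodic]

theorem lameQ_bound (h : JacobiTriple L s κ S C D) (m x : ℝ) :
    |lameQ s κ S m x| ≤ s ^ 2 * (6 * κ + |m|) := by
  rw [lameQ, abs_mul, abs_of_nonneg (sq_nonneg s)]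
  refine mul_le_mul_of_nonneg_left ?_ (sq_nonneg s)
  have hκ := h.pos_κ
  refine (abs_sub _ _).trans (add_le_add_left ?_ _)
  rw [abs_of_nonneg (by positivity)]
  nlinarith [h.S_sq_le_one x]

theorem hasDerivAt_S_sq (h : JacobiTriple L s κ S C D) (x : ℝ) :
    HasDerivAt (fun x => S x ^ 2) (2 * s * (S x * C x * D x)) x := by
  convert! (h.deriv_S x).pow 2 using 1
  push_cast
  ring

/-- With `z = S²`, `w = S C D` and `P(z) = z (1 - z) (1 - κ z)` one has `z' = 2 s w` and `w² =
P(z)`, which suggests the formula `w' = s P'(z)`. -/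
theorem hasDerivAt_SCD (h : JacobiTriple L s κ S C D) (x : ℝ) :
    HasDerivAt (fun x => S x * C x * D x)
      (s * (1 - 2 * (1 + κ) * S x ^ 2 + 3 * κ * (S x ^ 2) ^ 2)) x := by
  convert! ((h.deriv_S x).mul (h.deriv_C x)).mul (h.deriv_D x) using 1
  simp only [Pi.mul_apply]
  linear_combination (-s * D x ^ 2 + s * κ * S x ^ 2) * h.C_sq x +
    (-s * (1 - S x ^ 2) + s * S x ^ 2) * h.D_sq x

theorem hasDerivAt_lameQ (h : JacobiTriple L s κ S C D) (m x : ℝ) :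
    HasDerivAt (lameQ s κ S m) (12 * κ * s ^ 3 * (S x * C x * D x)) x := by
  convert! (((h.hasDerivAt_S_sq x).const_mul (6 * κ)).sub_const m).const_mul (s ^ 2) using 1
  ring

theorem continuous_lameQ (h : JacobiTriple L s κ S C D) (m : ℝ) : Continuous (lameQ s κ S m) :=
  continuous_iff_continuousAt.2 fun x => (h.hasDerivAt_lameQ m x).continuousAt

theorem lameQ_lt (h : JacobiTriple L s κ S C D) {m m' : ℝ} (hm : m < m') (x : ℝ) :
    lameQ s κ S m' x < lameQ s κ S m x :=
  mul_lt_mul_of_pos_left (by linarith) (pow_pos h.pos_s 2)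

theorem isSol_D (h : JacobiTriple L s κ S C D) :
    IsSol (fun x => s ^ 2 * (2 - κ) - 2 * s ^ 2 * D x ^ 2) D fun x => -(s * κ * (S x * C x)) := by
  refine ⟨h.deriv_D, fun x => ?_⟩
  convert! (((h.deriv_S x).mul (h.deriv_C x)).const_mul (s * κ)).neg using 1
  linear_combination (-2 * s ^ 2 * D x) * h.D_sq x + (s ^ 2 * κ * D x) * h.C_sq x

/-- This is the kernel of 𝓛₃: `S C` is a multiple of `D'`, and differentiating the equation of the
wave linearises it. -/
theorem isSol_SC (h : JacobiTriple L s κ S C D) :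
    IsSol (lameQ s κ S (4 + κ)) (fun x => S x * C x)
      fun x => s * (1 - 2 * S x ^ 2) * D x := by
  refine ⟨fun x => ?_, fun x => ?_⟩
  · convert! (h.deriv_S x).mul (h.deriv_C x) using 1
    linear_combination (-s * D x) * h.C_sq x
  · convert! ((((h.hasDerivAt_S_sq x).const_mul 2).const_sub 1).const_mul s).mul
      (h.deriv_D x) using 1
    rw [lameQ]
    linear_combination (4 * s ^ 2 * S x * C x) * h.D_sq x

/-- This band edge function and `S D` below are antiperiodic; they serve to exclude periodic
solutions at their values of `m`. -/
theorem isSol_CD (h : JacobiTriple L s κ S C D) :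
    IsSol (lameQ s κ S (1 + κ)) (fun x => C x * D x)
      fun x => -s * (S x * (1 + κ - 2 * κ * S x ^ 2)) := by
  refine ⟨fun x => ?_, fun x => ?_⟩
  · convert! (h.deriv_C x).mul (h.deriv_D x) using 1
    linear_combination (s * S x) * h.D_sq x + (s * κ * S x) * h.C_sq x
  · convert! ((h.deriv_S x).mul
      (((h.hasDerivAt_S_sq x).const_mul (2 * κ)).const_sub (1 + κ))).const_mul (-s) using 1
    rw [lameQ]
    ring

theorem isSol_SD (h : JacobiTriple L s κ S C D) :
    IsSol (lameQ s κ S (1 + 4 * κ)) (fun x => S x * D x)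
      fun x => s * (C x * (1 - 2 * κ * S x ^ 2)) := by
  refine ⟨fun x => ?_, fun x => ?_⟩
  · convert! (h.deriv_S x).mul (h.deriv_D x) using 1
    linear_combination (-s * C x) * h.D_sq x
  · convert! ((h.deriv_C x).mul
      (((h.hasDerivAt_S_sq x).const_mul (2 * κ)).const_sub 1)).const_mul s using 1
    rw [lameQ]
    linear_combination (4 * s ^ 2 * κ * S x * D x) * h.C_sq x

/-- The constant term of the equation forces `m = 2 a`, the coefficient of `S²` is the quadratic
condition on `a`, and the coefficients of `S⁴` agree. -/
theorem isSol_quadratic (h : JacobiTriple L s κ S C D) {a : ℝ}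
    (ha : a ^ 2 - 2 * (1 + κ) * a + 3 * κ = 0) :
    IsSol (lameQ s κ S (2 * a)) (fun x => 1 - a * S x ^ 2)
      fun x => -(2 * a * s) * (S x * C x * D x) := by
  refine ⟨fun x => ?_, fun x => ?_⟩
  · convert! ((h.hasDerivAt_S_sq x).const_mul a).const_sub 1 using 1
    ring
  · convert! (h.hasDerivAt_SCD x).const_mul (-(2 * a * s)) using 1
    rw [lameQ]
    linear_combination (2 * s ^ 2 * S x ^ 2) * ha

/-- Outside the five band edges, one periodic solution makes all solutions periodic. -/
theorem periodic_of_ne (h : JacobiTriple L s κ S C D)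
    (hm : (m - 4 - κ) * (m - 1 - 4 * κ) * (m - 1 - κ) *
      (m ^ 2 - 4 * (1 + κ) * m + 12 * κ) ≠ 0)
    {u u' w w' : ℝ → ℝ} (hu : IsSol (lameQ s κ S m) u u') (hx : ∃ x, u x ≠ 0)
    (hup : u.Periodic L) (hw : IsSol (lameQ s κ S m) w w') : w.Periodic L := by
  have hκ := h.pos_κ.ne'
  have hs := h.pos_s.ne'
  -- `B` and `A` are found by matching coefficients of powers of `S²` in `F''' = 4 q F' + 2 q' F`.
  set B := (m - 4 * (1 + κ)) / (3 * κ) with hB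
  set A := (3 + (m - (1 + κ)) * B) / (3 * κ) with hA
  have hB' : 3 * κ * B = m - 4 * (1 + κ) := by rw [hB]; field_simp
  have hA' : 3 * κ * A = 3 + (m - (1 + κ)) * B := by rw [hA]; field_simp
  -- the function `F = S⁴ + B S² + A` and its derivatives
  have hF : ∀ x, HasDerivAt (fun x => (S x ^ 2) ^ 2 + B * S x ^ 2 + A)
      (2 * s * (2 * S x ^ 2 + B) * (S x * C x * D x)) x := fun x => by
    convert! (((h.hasDerivAt_S_sq x).pow 2).add ((h.hasDerivAt_S_sq x).const_mul B)).add_const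
      A using 1
    push_cast
    ring
  have hF₁ : ∀ x, HasDerivAt (fun x => 2 * s * (2 * S x ^ 2 + B) * (S x * C x * D x))
      (2 * s ^ 2 * (4 * (S x ^ 2 * (1 - S x ^ 2) * (1 - κ * S x ^ 2)) +
        (2 * S x ^ 2 + B) * (1 - 2 * (1 + κ) * S x ^ 2 + 3 * κ * (S x ^ 2) ^ 2))) x := fun x => by
    convert! ((((h.hasDerivAt_S_sq x).const_mul 2).add_const B).const_mul (2 * s)).mul
      (h.hasDerivAt_SCD x) using 1
    linear_combination (-8 * s ^ 2 * S x ^ 2 * D x ^ 2) * h.C_sq x -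
      (8 * s ^ 2 * S x ^ 2 * (1 - S x ^ 2)) * h.D_sq x
  have hF₂ : ∀ x, HasDerivAt (fun x => 2 * s ^ 2 * (4 * (S x ^ 2 * (1 - S x ^ 2) *
        (1 - κ * S x ^ 2)) +
        (2 * S x ^ 2 + B) * (1 - 2 * (1 + κ) * S x ^ 2 + 3 * κ * (S x ^ 2) ^ 2)))
      (4 * s ^ 3 * (S x * C x * D x) * (6 * (1 - 2 * (1 + κ) * S x ^ 2 + 3 * κ * (S x ^ 2) ^ 2) +
        (2 * S x ^ 2 + B) * (6 * κ * S x ^ 2 - 2 * (1 + κ)))) x := fun x => by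
    have hz := h.hasDerivAt_S_sq x
    convert! ((((hz.mul (hz.const_sub 1)).mul ((hz.const_mul κ).const_sub 1)).const_mul 4).add
      (((hz.const_mul 2).add_const B).mul (((hz.const_mul (2 * (1 + κ))).const_sub 1).add
        ((hz.pow 2).const_mul (3 * κ))))).const_mul (2 * s ^ 2) using 1
    simp only [Pi.mul_apply, Pi.add_apply, Pi.pow_apply]
    push_cast
    ring
  refine hu.periodic_of_intertwine (x₀ := 0) (h.lameQ_periodic m) (h.lameQ_bound m)
    (h.hasDerivAt_lameQ m) hF hF₁ hF₂ (fun x => ?_) (fun x => ?_) (fun x => ?_) (fun x => ?_) ?_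
    hx hup hw
  · rw [lameQ]
    linear_combination (-8 * s ^ 3 * (S x * C x * D x)) * ((2 * S x ^ 2) * hB' + hA')
  · simp only [h.S_sq_periodic]
  · simp only [h.S_add, h.C_add, h.D_add]
    ring
  · simp only [h.S_sq_periodic]
  -- The first integral is evaluated at `0`, where `S = 0`, `F = A`, `F' = 0`, `F'' = 2 s² B`, `q =
  -- -s² m`. Clearing the denominators of `A` and `B` by `81 κ⁴` leaves the quintic of the five band
  -- edges.
  · have e : (A * (2 * s ^ 2 * B) / 2 - 0 ^ 2 / 4 - s ^ 2 * (-m) * A ^ 2) * (81 * κ ^ 4) =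
        s ^ 2 * ((m - 4 - κ) * (m - 1 - 4 * κ) * (m - 1 - κ) *
          (m ^ 2 - 4 * (1 + κ) * m + 12 * κ)) := by
      rw [hA, hB]
      field_simp
      ring
    intro h0
    simp only [lameQ, h.S_zero] at h0
    have h1 : A * (2 * s ^ 2 * B) / 2 - 0 ^ 2 / 4 - s ^ 2 * (-m) * A ^ 2 = 0 := by
      linear_combination h0
    rw [h1, zero_mul] at e
    exact mul_ne_zero (pow_ne_zero 2 hs) hm e.symm

/-! ### Band edges and multiplicity of the periodic Lamé eigenvalues -/

/-- The coefficient `1 + k² ± √(1 - k² + k⁴)` of the band edge functions `1 - a sn²`. -/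
def edge (κ ε : ℝ) : ℝ := 1 + κ + ε * √(1 - κ + κ ^ 2)

theorem edge_eq (κ : ℝ) {ε : ℝ} (hε : ε ^ 2 = 1) :
    edge κ ε ^ 2 - 2 * (1 + κ) * edge κ ε + 3 * κ = 0 := by
  have h := Real.sq_sqrt (show 0 ≤ 1 - κ + κ ^ 2 by nlinarith [sq_nonneg (κ - 1 / 2)])
  rw [edge]
  linear_combination √(1 - κ + κ ^ 2) ^ 2 * hε + h

/-- These bounds place the edge `4 + κ` strictly between the other two periodic ones. They come from
comparing `1 - κ + κ²` with `κ²` and with `(1 - κ/2)²`. -/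
theorem edge_lt (h0 : 0 < κ) (h1 : κ < 1) : edge κ (-1) < 1 ∧ 4 + κ < 2 * edge κ 1 := by
  have h2 := Real.sq_sqrt (show 0 ≤ 1 - κ + κ ^ 2 by nlinarith [sq_nonneg (κ - 1 / 2)])
  have h3 := Real.sqrt_nonneg (1 - κ + κ ^ 2)
  constructor
  · have h4 : κ < √(1 - κ + κ ^ 2) := Real.lt_sqrt_of_sq_lt (by linarith)
    rw [edge]; linarith
  · have h4 : 1 - κ / 2 < √(1 - κ + κ ^ 2) := Real.lt_sqrt_of_sq_lt (by nlinarith)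
    rw [edge]; linarith

/-- Up to the third periodic band edge not all solutions are periodic. -/
theorem exists_not_periodic (h : JacobiTriple L s κ S C D) (hm : m ≤ 2 * edge κ 1) :
    ∃ w w', IsSol (lameQ s κ S m) w w' ∧ ¬ w.Periodic L := by
  obtain ⟨-, he⟩ := edge_lt h.pos_κ h.lt_one
  have hL := h.pos_L
  have hκ := h.pos_κ
  obtain ⟨x₀, h0, h1, h2, h3, hin, hout⟩ := h.exists_zero (a := edge κ 1) (by linarith)
  have hy := h.isSol_quadratic (edge_eq κ (one_pow 2))
  have hback : ∀ x, S (x - L) ^ 2 = S x ^ 2 := fun x => by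
    rw [← h.S_sq_periodic (x - L), sub_add_cancel]
  rcases hm.lt_or_eq with hm | rfl
  -- Below the edge: `f` starts at the zero `-x₀` of `y = 1 - a S²`, which lies between the
  -- neighbouring zeros `x₀ - L` and `x₀`.
  · obtain ⟨f, f', hf, hf0, hf1⟩ :=
      exists_isSol (h.continuous_lameQ m) (h.lameQ_bound m) (-x₀)
    refine ⟨f, f', hf, hf.not_periodic_of_comparison hy (h.lameQ_lt hm) (a := -x₀) (b := x₀) hf0
      (by rw [hf1]; exact one_pos) (by linarith) (by linarith) h3 h2 ?_ hin fun x h4 h5 => ?_⟩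
    · rw [hback, h2]
    · rw [← h.S_sq_periodic]
      exact hout _ (by linarith) (by linarith)
  -- At the edge itself: `y` is even with `y 0 ≠ 0`, so the solution vanishing at `0` is independent
  -- of it. It is played off against `S C`, which belongs to the lower edge and vanishes at `0` and
  -- `±L / 2`.
  · obtain ⟨f, f', hf, hf0, hf1⟩ :=
      exists_isSol (h.continuous_lameQ (2 * edge κ 1)) (h.lameQ_bound _) 0
    have hC : C (L / 2) = 0 := by
      have := h.C_sq (L / 2)
      rw [h.S_half] at this
      exact pow_eq_zero_iff two_ne_zero |>.1 (by linarith)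
    have hC' : C (-(L / 2)) = 0 := by
      have := h.C_sq (-(L / 2))
      rw [h.S_neg, h.S_half] at this
      exact pow_eq_zero_iff two_ne_zero |>.1 (by linarith)
    refine ⟨f, f', hf, hf.not_periodic_of_interlacing hy h.isSol_SC (h.lameQ_lt he) hL hf0
      (by rw [hf1]; exact one_pos) (by simp [h.S_zero]) ?_ (by simp [hC]) (by simp [hC'])
      (fun x h4 h5 => (hin x h4 h5).ne') (fun x h4 h5 => (hout x h4 h5).ne) h0 h2 h3⟩
    simpa [h.S_zero] using mul_pos h.pos_s (h.pos_D 0)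

/-- Two independent periodic solutions would make every solution periodic. -/
theorem exists_mul_of_periodic (h : JacobiTriple L s κ S C D) (hm : m ≤ 2 * edge κ 1)
    {u u' w w' : ℝ → ℝ} (hu : IsSol (lameQ s κ S m) u u') (hx : ∃ x, u x ≠ 0)
    (hup : u.Periodic L) (hw : IsSol (lameQ s κ S m) w w') (hwp : w.Periodic L) :
    ∃ a : ℝ, ∀ x, w x = a * u x := by
  obtain ⟨g, g', hg, hgp⟩ := h.exists_not_periodic hm
  have hW : u 0 * w' 0 - u' 0 * w 0 = 0 := by
    by_contra hne
    obtain ⟨a, b, h1, -⟩ := hu.eq_combination hw hg hne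
    exact hgp fun x => by rw [h1, h1, hup, hwp]
  obtain ⟨a, h1, -⟩ := hu.eq_mul_of_wronskian_eq_zero (h.continuous_lameQ m) (h.lameQ_bound m) hx
    hw hW
  exact ⟨a, h1⟩

/-- The periodic eigenvalues other than the three simple ones lie above these and are double. -/
theorem double_of_ne (h : JacobiTriple L s κ S C D) (h0 : m ≠ 2 * edge κ (-1)) (h1 : m ≠ 4 + κ)
    (h2 : m ≠ 2 * edge κ 1) {u u' : ℝ → ℝ} (hu : IsSol (lameQ s κ S m) u u') (hx : ∃ x, u x ≠ 0)
    (hup : u.Periodic L) :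
    2 * edge κ 1 < m ∧ ∀ w w', IsSol (lameQ s κ S m) w w' → w.Periodic L := by
  have h3 : m ≠ 1 + κ := by
    rintro rfl
    obtain ⟨x, hx⟩ := hx
    exact hx (h.isSol_CD.eq_zero_of_antiperiodic (h.continuous_lameQ _) (h.lameQ_bound _)
      ⟨0, by rw [h.C_zero, one_mul]; exact (h.pos_D 0).ne'⟩
      (fun x => by rw [h.C_add, h.D_add, neg_mul]) hu hup x)
  have h4 : m ≠ 1 + 4 * κ := by
    rintro rfl
    obtain ⟨x, hx⟩ := hx
    exact hx (h.isSol_SD.eq_zero_of_antiperiodic (h.continuous_lameQ _) (h.lameQ_bound _)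
      ⟨L / 2, by rw [h.S_half, one_mul]; exact (h.pos_D _).ne'⟩
      (fun x => by rw [h.S_add, h.D_add, neg_mul]) hu hup x)
  have h5 : m ^ 2 - 4 * (1 + κ) * m + 12 * κ = (m - 2 * edge κ 1) * (m - 2 * edge κ (-1)) := by
    have h6 : edge κ 1 + edge κ (-1) = 2 * (1 + κ) := by rw [edge, edge]; ring
    have h7 := edge_eq κ (one_pow 2)
    linear_combination (2 * m - 4 * edge κ 1) * h6 + 4 * h7
  have hall : ∀ w w', IsSol (lameQ s κ S m) w w' → w.Periodic L := fun w w' hw => by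
    refine h.periodic_of_ne (mul_ne_zero (mul_ne_zero (mul_ne_zero ?_ ?_) ?_) ?_) hu hx hup hw
    · intro h6; exact h1 (by linarith)
    · intro h6; exact h4 (by linarith)
    · intro h6; exact h3 (by linarith)
    · rw [h5]; exact mul_ne_zero (sub_ne_zero.2 h2) (sub_ne_zero.2 h0)
  refine ⟨?_, hall⟩
  by_contra hn
  obtain ⟨w, w', hw, hwp⟩ := h.exists_not_periodic (not_lt.1 hn)
  exact hwp (hall w w' hw)

end JacobiTriple

/-! ## Operators with compact resolvent -/

/-- Finite initial segments make `s` a locally finite linear order with a least element; being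
infinite, it has no greatest one and is isomorphic to `ℕ`. -/
theorem strictMono_enumeration {s : Set ℝ} (hs : s.Infinite) (hfin : ∀ a, (s ∩ Set.Iic a).Finite) :
    ∃ ev : ℕ → ℝ, StrictMono ev ∧ Tendsto ev atTop atTop ∧ Set.range ev = s := by
  classical
  have hfin' : ∀ a : s, (Set.Iic a).Finite := fun a =>
    Set.Finite.of_finite_image ((hfin a).subset (by
      rintro _ ⟨b, hb, rfl⟩
      exact ⟨b.2, hb⟩)) Subtype.val_injective.injOn
  have hne : Nonempty s := hs.nonempty.to_subtype
  let : LocallyFiniteOrderBot s := LocallyFiniteOrderBot.ofIic s (fun a => (hfin' a).toFinset)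
    (fun a x => by simp)
  obtain ⟨b, hb⟩ : ∃ b : s, ∀ x, b ≤ x := by
    obtain ⟨a⟩ := hne
    obtain ⟨b, hb, hmin⟩ := (hfin' a).exists_minimal ⟨a, le_refl a⟩
    refine ⟨b, fun x => ?_⟩
    rcases le_total b x with h | h
    · exact h
    · exact hmin (h.trans hb) h
  let : OrderBot s := { bot := b, bot_le := hb }
  have : NoMaxOrder s := by
    refine ⟨fun a => ?_⟩
    by_contra! hn
    exact hs (((hfin a).subset fun x hx => ⟨hx, hn ⟨x, hx⟩⟩))
  let : LocallyFiniteOrder s := LocallyFiniteOrder.ofIcc s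
    (fun a c => ((hfin' c).inter_of_right (Set.Ici a)).toFinset)
    (fun a c x => by simp)
  let := LinearLocallyFiniteOrder.succOrder s
  let := LinearLocallyFiniteOrder.predOrder s
  let e : s ≃o ℕ := orderIsoNatOfLinearSuccPredArch
  have hmono : StrictMono fun n => (e.symm n : ℝ) := fun m n h => e.symm.strictMono h
  have hrange : Set.range (fun n => (e.symm n : ℝ)) = s := by
    ext x
    exact ⟨fun ⟨n, hn⟩ => hn ▸ (e.symm n).2, fun hx => ⟨e ⟨x, hx⟩, by simp⟩⟩
  refine ⟨_, hmono, ?_, hrange⟩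
  refine tendsto_atTop_atTop_of_monotone hmono.monotone fun a => ?_
  by_contra! hn
  refine Set.infinite_univ (α := ℕ) ?_
  refine Set.Finite.of_finite_image (f := fun n => (e.symm n : ℝ)) ((hfin a).subset ?_)
    hmono.injective.injOn
  rintro _ ⟨n, -, rfl⟩
  exact ⟨(e.symm n).2, (hn n).le⟩

section CompactResolvent

variable {E : Type*} [NormedAddCommGroup E] [InnerProductSpace ℂ E]

open Module.End in
/-- A compact symmetric operator has only finitely many eigenvalues away from zero. -/
theorem finite_eigenvalues_of_le_norm {G : E →L[ℂ] E} (hG : IsCompactOperator G)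
    (hS : (G : E →ₗ[ℂ] E).IsSymmetric) {ε : ℝ} (hε : 0 < ε) :
    {w : ℂ | HasEigenvalue (G : E →ₗ[ℂ] E) w ∧ ε ≤ ‖w‖}.Finite := by
  by_contra hinf
  have f := Set.Infinite.natEmbedding _ hinf
  have hv : ∀ n, ∃ v : E, G v = (f n : ℂ) • v ∧ ‖v‖ = 1 := by
    intro n
    obtain ⟨v, hv⟩ := (f n).2.1.exists_hasEigenvector
    refine ⟨((‖v‖ : ℂ)⁻¹) • v, ?_, ?_⟩
    · have h1 : G v = (f n : ℂ) • v := hv.apply_eq_smul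
      rw [map_smul, h1, smul_comm]
    · exact norm_smul_inv_norm hv.2
  choose v hv hv1 using hv
  have horth : ∀ n m, n ≠ m → inner ℂ (v n) (v m) = 0 := by
    intro n m hnm
    have h := hS.orthogonalFamily_eigenspaces (i := (f n : ℂ)) (j := (f m : ℂ))
      (fun h => hnm (f.injective (Subtype.ext h))) ⟨v n, mem_eigenspace_iff.2 (hv n)⟩
      ⟨v m, mem_eigenspace_iff.2 (hv m)⟩
    simpa using h
  -- Infinitely many such eigenvalues would give orthonormal eigenvectors with `ε`-separated images,
  -- which have no Cauchy subsequence.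
  have hsep : ∀ n m, n ≠ m → ε ≤ ‖G (v n) - G (v m)‖ := by
    intro n m hnm
    have h0 : inner ℂ (G (v n)) (G (v m)) = 0 := by
      rw [hv, hv, inner_smul_left, inner_smul_right, horth n m hnm, mul_zero, mul_zero]
    have h1 : ‖G (v n) - G (v m)‖ ^ 2 = ‖(f n : ℂ)‖ ^ 2 + ‖(f m : ℂ)‖ ^ 2 := by
      rw [@norm_sub_sq ℂ, h0, hv, hv, norm_smul, norm_smul, hv1, hv1]
      simp
    have h2 : ε ^ 2 ≤ ‖G (v n) - G (v m)‖ ^ 2 := by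
      rw [h1]
      nlinarith [(f n).2.2, sq_nonneg ‖(f m : ℂ)‖]
    exact (sq_le_sq₀ hε.le (norm_nonneg _)).1 h2
  obtain ⟨K, hK, hK'⟩ := hG.image_closedBall_subset_compact 1
  obtain ⟨y, -, ψ, hψ, hlim⟩ := hK.tendsto_subseq
    (fun n => hK' ⟨v n, by simp [hv1], rfl⟩)
  obtain ⟨N, hN⟩ := Metric.cauchySeq_iff'.1 hlim.cauchySeq ε hε
  have h1 := hN (N + 1) (by omega)
  rw [dist_eq_norm] at h1
  exact absurd h1 (not_lt.2 (hsep _ _ (hψ.injective.ne (by omega))))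

/-- `G` is the inverse of `T + C`. -/
structure IsShiftedInverse (T : E →ₗ.[ℂ] E) (C : ℝ) (G : E →L[ℂ] E) : Prop where
  right : ∀ y, ∃ h : G y ∈ T.domain, T ⟨G y, h⟩ + (C : ℂ) • G y = y
  left : ∀ x : T.domain, G (T x + (C : ℂ) • (x : E)) = x

namespace IsShiftedInverse

variable {T : E →ₗ.[ℂ] E} {C : ℝ} {G : E →L[ℂ] E}

theorem mem_eigenspace_iff (h : IsShiftedInverse T C G) {z : ℂ} {x : E} :
    x ∈ pmapEigenspace T z ↔ (z + C) • G x = x := by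
  constructor
  · rintro ⟨hx, e⟩
    have h1 := h.left ⟨x, hx⟩
    rw [e, ← add_smul, map_smul] at h1
    exact h1
  · intro e
    obtain ⟨hd, hy⟩ := h.right x
    have hx : x ∈ T.domain := e ▸ T.domain.smul_mem _ hd
    refine ⟨hx, ?_⟩
    have h1 : (⟨x, hx⟩ : T.domain) = (z + C) • ⟨G x, hd⟩ := Subtype.ext e.symm
    have h2 : T ⟨x, hx⟩ = (z + C) • T ⟨G x, hd⟩ := by rw [h1]; exact T.map_smul _ _
    rw [h2, eq_sub_of_add_eq hy, smul_sub, smul_comm, e]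
    module

theorem eigenspace_eq (h : IsShiftedInverse T C G) {z : ℂ} (hz : z + C ≠ 0) :
    pmapEigenspace T z = Module.End.eigenspace (G : E →ₗ[ℂ] E) (z + C)⁻¹ := by
  ext x
  rw [h.mem_eigenspace_iff, Module.End.mem_eigenspace_iff, eq_inv_smul_iff₀ hz]
  rfl

theorem eigenspace_eq_bot (h : IsShiftedInverse T C G) {z : ℂ} (hz : z + C = 0) :
    pmapEigenspace T z = ⊥ := by
  rw [eq_bot_iff]
  intro x hx
  rw [h.mem_eigenspace_iff, hz, zero_smul] at hx
  exact hx.symm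

theorem hasEigenvalue (h : IsShiftedInverse T C G) {z : ℂ} (hz : pmapEigenspace T z ≠ ⊥) :
    z + C ≠ 0 ∧ Module.End.HasEigenvalue (G : E →ₗ[ℂ] E) (z + C)⁻¹ := by
  have h0 : z + C ≠ 0 := fun h0 => hz (h.eigenspace_eq_bot h0)
  refine ⟨h0, ?_⟩
  rw [Module.End.hasEigenvalue_iff, ← h.eigenspace_eq h0]
  exact hz

/-- Fredholm alternative for the compact `G`: if `(z + C)⁻¹` is not an eigenvalue of `G`, it is in
the resolvent set of `G`, which yields a bounded inverse of `T - z`. -/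
theorem mem_spectrum_iff [CompleteSpace E] (h : IsShiftedInverse T C G) (hG : IsCompactOperator G)
    {z : ℂ} : z ∈ pmapSpectrum T ↔ pmapEigenspace T z ≠ ⊥ := by
  constructor
  · intro hz hbot
    refine hz ?_
    by_cases h0 : z + C = 0
    · have hzC : z = -C := eq_neg_of_add_eq_zero_left h0
      refine ⟨G, fun y => ?_, fun x => ?_⟩
      · obtain ⟨hd, hy⟩ := h.right y
        exact ⟨hd, by rw [hzC, neg_smul, sub_neg_eq_add, hy]⟩
      · rw [hzC, neg_smul, sub_neg_eq_add, h.left]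
    · have hw : (z + C)⁻¹ ≠ 0 := inv_ne_zero h0
      have hres := (hG.hasEigenvalue_or_mem_resolventSet hw).resolve_left (by
        rw [Module.End.hasEigenvalue_iff, ← h.eigenspace_eq h0, not_not]
        exact hbot)
      obtain ⟨U, hU⟩ := spectrum.mem_resolventSet_iff.1 hres
      have hUl : ∀ y, (↑U⁻¹ : E →L[ℂ] E) ((z + C)⁻¹ • y - G y) = y := fun y => by
        have := DFunLike.congr_fun U.inv_mul y
        rw [hU] at this
        simpa [Algebra.algebraMap_eq_smul_one] using this
      have hUr : ∀ y, (z + C)⁻¹ • (↑U⁻¹ : E →L[ℂ] E) y - G ((↑U⁻¹ : E →L[ℂ] E) y) = y := fun y => by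
        have := DFunLike.congr_fun U.mul_inv y
        rw [hU] at this
        simpa [Algebra.algebraMap_eq_smul_one] using this
      -- The factorisation `T - z = (z + C) ((z + C)⁻¹ - G) (T + C)`.
      have key : ∀ (x : T.domain) (y : E), (x : E) = G y → T x + (C : ℂ) • (x : E) = y →
          T x - z • (x : E) = (z + C) • ((z + C)⁻¹ • y - G y) := by
        intro x y e1 e2
        rw [smul_sub, smul_inv_smul₀ h0, ← e1, ← e2]
        module
      refine ⟨(z + C)⁻¹ • (G ∘L (↑U⁻¹ : E →L[ℂ] E)), fun y => ?_, fun x => ?_⟩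
      · obtain ⟨hd, hy⟩ := h.right ((↑U⁻¹ : E →L[ℂ] E) y)
        have hd' := T.domain.smul_mem (z + C)⁻¹ hd
        refine ⟨hd', ?_⟩
        have h2 : T ⟨(z + C)⁻¹ • G ((↑U⁻¹ : E →L[ℂ] E) y), hd'⟩ =
            (z + C)⁻¹ • T ⟨G ((↑U⁻¹ : E →L[ℂ] E) y), hd⟩ := T.map_smul _ ⟨_, hd⟩
        change T ⟨(z + C)⁻¹ • G ((↑U⁻¹ : E →L[ℂ] E) y), hd'⟩ -
          z • ((z + C)⁻¹ • G ((↑U⁻¹ : E →L[ℂ] E) y)) = y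
        rw [h2, smul_comm z, ← smul_sub, key ⟨_, hd⟩ _ rfl hy, inv_smul_smul₀ h0, hUr]
      · have h2 := key x (T x + (C : ℂ) • (x : E)) (h.left x).symm rfl
        change (z + C)⁻¹ • G ((↑U⁻¹ : E →L[ℂ] E) (T x - z • (x : E))) = x
        rw [h2, map_smul, map_smul, inv_smul_smul₀ h0, hUl, h.left]
  · rintro hz ⟨R, -, hR⟩
    refine hz ((Submodule.eq_bot_iff _).2 ?_)
    rintro x ⟨hx, e⟩
    have h1 := hR ⟨x, hx⟩
    rw [e, sub_self, map_zero] at h1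
    exact h1.symm

end IsShiftedInverse

/-- The spectrum of a symmetric operator that is bounded below and has compact resolvent. -/
theorem exists_eigenvalue_sequence [CompleteSpace E] (hE : ¬ FiniteDimensional ℂ E)
    {T : E →ₗ.[ℂ] E} {C₀ : ℝ} (hT : ∀ C, C₀ ≤ C → ∃ G : E →L[ℂ] E, IsCompactOperator G ∧
      (G : E →ₗ[ℂ] E).IsSymmetric ∧ IsShiftedInverse T C G) :
    ∃ ev : ℕ → ℝ, StrictMono ev ∧ Tendsto ev atTop atTop ∧
      pmapSpectrum T = Set.range (fun n => (ev n : ℂ)) ∧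
      Set.range ev = {t : ℝ | pmapEigenspace T t ≠ ⊥} ∧
      ∀ z, FiniteDimensional ℂ (pmapEigenspace T z) := by
  obtain ⟨G, hG, hS, h⟩ := hT C₀ le_rfl
  have hfd : ∀ z, FiniteDimensional ℂ (pmapEigenspace T z) := by
    intro z
    by_cases h0 : z + C₀ = 0
    · rw [h.eigenspace_eq_bot h0]; infer_instance
    · rw [h.eigenspace_eq h0]
      exact ContinuousLinearMap.finite_dimensional_eigenspace hG _ (inv_ne_zero h0)
  have hreal : ∀ z, pmapEigenspace T z ≠ ⊥ → ((z.re : ℝ) : ℂ) = z := by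
    intro z hz
    have h1 := hS.conj_eigenvalue_eq_self (h.hasEigenvalue hz).2
    rw [map_inv₀, inv_inj, map_add, Complex.conj_ofReal, add_left_inj] at h1
    exact Complex.conj_eq_iff_re.1 h1
  -- For `t ≤ -C₀` the shift `C = -t` is admissible, so `T - t` is invertible.
  have hlow : ∀ t : ℝ, pmapEigenspace T t ≠ ⊥ → 0 < t + C₀ := by
    intro t ht
    by_contra hn
    obtain ⟨G', -, -, h'⟩ := hT (-t) (by linarith)
    exact ht (h'.eigenspace_eq_bot (by push_cast; ring))
  have hfin : ∀ a, ({t : ℝ | pmapEigenspace T t ≠ ⊥} ∩ Set.Iic a).Finite := by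
    intro a
    by_cases ha : 0 < a + C₀
    · refine Set.Finite.of_finite_image (f := fun t : ℝ => ((t : ℂ) + C₀)⁻¹)
        ((finite_eigenvalues_of_le_norm hG hS (one_div_pos.2 ha)).subset ?_) ?_
      · rintro _ ⟨t, ⟨ht, hta⟩, rfl⟩
        refine ⟨(h.hasEigenvalue ht).2, ?_⟩
        have h1 := hlow t ht
        rw [norm_inv, ← Complex.ofReal_add, Complex.norm_of_nonneg h1.le, ← one_div]
        exact one_div_le_one_div_of_le h1 (by linarith [Set.mem_Iic.1 hta])
      · intro t _ t' _ e
        simpa using e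
    · convert! Set.finite_empty (α := ℝ)
      rw [Set.eq_empty_iff_forall_notMem]
      rintro t ⟨ht, hta⟩
      linarith [hlow t ht, Set.mem_Iic.1 hta]
  -- Finitely many eigenvalues would make the sum of the eigenspaces of `G` finite-dimensional. By
  -- the spectral theorem its orthogonal complement is zero, so `E` would be finite-dimensional.
  have hinf : {t : ℝ | pmapEigenspace T t ≠ ⊥}.Infinite := by
    intro hf
    have hbot := ContinuousLinearMap.orthogonalComplement_iSup_eigenspaces_eq_bot hG hS
    have hle : (⨆ μ, Module.End.eigenspace (G : E →ₗ[ℂ] E) μ) ≤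
        ⨆ t ∈ hf.toFinset, pmapEigenspace T (t : ℂ) := by
      refine iSup_le fun μ x hx => ?_
      by_cases hx0 : x = 0
      · rw [hx0]; exact Submodule.zero_mem _
      have hGx : G x = μ • x := Module.End.mem_eigenspace_iff.1 hx
      -- `G` is injective, so it has no eigenvector with eigenvalue zero.
      have hμ : μ ≠ 0 := by
        rintro rfl
        obtain ⟨hd, hy⟩ := h.right x
        have h1 : (⟨G x, hd⟩ : T.domain) = 0 := Subtype.ext (hGx.trans (zero_smul ℂ x))
        rw [h1, T.map_zero, hGx, zero_smul, smul_zero, add_zero] at hy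
        exact hx0 hy.symm
      have hmem : x ∈ pmapEigenspace T (μ⁻¹ - C₀) := by
        rw [h.mem_eigenspace_iff, sub_add_cancel, hGx, inv_smul_smul₀ hμ]
      have hne : pmapEigenspace T (μ⁻¹ - C₀) ≠ ⊥ := fun hb => hx0 (by simpa [hb] using hmem)
      rw [← hreal _ hne] at hmem hne
      exact Submodule.mem_iSup_of_mem _ (Submodule.mem_iSup_of_mem (hf.mem_toFinset.2 hne) hmem)
    have hfd' : FiniteDimensional ℂ
        (⨆ μ, Module.End.eigenspace (G : E →ₗ[ℂ] E) μ : Submodule ℂ E) := by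
      have : FiniteDimensional ℂ
          (⨆ t ∈ hf.toFinset, pmapEigenspace T (t : ℂ) : Submodule ℂ E) := by
        have := fun t : ℝ => hfd t
        exact Submodule.finiteDimensional_finset_sup _ _ |> fun i => by
          rwa [Finset.sup_eq_iSup] at i
      exact Submodule.finiteDimensional_of_le hle
    have htop := Submodule.orthogonal_eq_bot_iff.1 hbot
    rw [htop] at hfd'
    exact hE (Module.Finite.of_surjective (Submodule.subtype ⊤) fun x => ⟨⟨x, trivial⟩, rfl⟩)
  obtain ⟨ev, h1, h2, h3⟩ := strictMono_enumeration hinf hfin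
  refine ⟨ev, h1, h2, ?_, h3, hfd⟩
  ext z
  rw [h.mem_spectrum_iff hG]
  constructor
  · intro hz
    have h4 := hreal z hz
    have h5 : z.re ∈ Set.range ev := by
      rw [h3]; exact (h4.symm ▸ hz :)
    obtain ⟨n, hn⟩ := h5
    exact ⟨n, by dsimp only; rw [hn, h4]⟩
  · rintro ⟨n, rfl⟩
    have h5 : ev n ∈ {t : ℝ | pmapEigenspace T t ≠ ⊥} := h3 ▸ Set.mem_range_self n
    exact h5

end CompactResolvent

/-! ## Diagonal operators -/

section Diagonal

variable {ι E : Type*} [NormedAddCommGroup E] [InnerProductSpace ℂ E] [CompleteSpace E]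

/-- The operator with eigenbasis `b` and summable eigenvalues `m`. -/
def diagOp (b : HilbertBasis ι ℂ E) (m : ι → ℝ) : E →L[ℂ] E :=
  ∑' n, (m n : ℂ) • InnerProductSpace.rankOne ℂ (b n) (b n)

theorem hasSum_diagOp (b : HilbertBasis ι ℂ E) {m : ι → ℝ} (hm : Summable m) :
    HasSum (fun n => (m n : ℂ) • InnerProductSpace.rankOne ℂ (b n) (b n)) (diagOp b m) := by
  refine Summable.hasSum (Summable.of_norm ?_)
  simpa [norm_smul, b.orthonormal.norm_eq_one] using hm.abs

theorem repr_diagOp (b : HilbertBasis ι ℂ E) {m : ι → ℝ} (hm : Summable m) (f : E) (n : ι) :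
    b.repr (diagOp b m f) n = m n * b.repr f n := by
  have h := ((hasSum_diagOp b hm).mapL (ContinuousLinearMap.apply ℂ E f)).mapL
    (innerSL ℂ (b n))
  rw [b.repr_apply_apply, b.repr_apply_apply]
  refine h.unique ?_
  have h2 : (m n : ℂ) * inner ℂ (b n) f = innerSL ℂ (b n)
      (ContinuousLinearMap.apply ℂ E f ((m n : ℂ) • InnerProductSpace.rankOne ℂ (b n) (b n))) := by
    simp [b.orthonormal.norm_eq_one]
  rw [h2]
  refine hasSum_single n fun k hk => ?_
  simp [b.orthonormal.inner_eq_zero hk.symm]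

/-- A limit in norm of finite sums of rank one operators. -/
theorem isCompactOperator_diagOp (b : HilbertBasis ι ℂ E) {m : ι → ℝ} (hm : Summable m) :
    IsCompactOperator (diagOp b m) := by
  refine isCompactOperator_of_tendsto (hasSum_diagOp b hm) (Eventually.of_forall fun s => ?_)
  induction s using Finset.cons_induction with
  | empty => simpa using! isCompactOperator_zero
  | cons n s hn ih =>
    rw [Finset.sum_cons]
    refine IsCompactOperator.add (IsCompactOperator.smul ?_ (m n : ℂ)) ih
    rw [InnerProductSpace.rankOne_def']
    have h : IsCompactOperator (innerSL ℂ (b n)) :=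
      isCompactOperator_of_locallyCompactSpace_dom _
    exact h.clm_comp (ContinuousLinearMap.toSpanSingleton ℂ (b n))

theorem isSymmetric_diagOp (b : HilbertBasis ι ℂ E) {m : ι → ℝ} (hm : Summable m) :
    (diagOp b m : E →ₗ[ℂ] E).IsSymmetric := by
  intro x y
  rw [← b.repr.inner_map_map, ← b.repr.inner_map_map, lp.inner_eq_tsum, lp.inner_eq_tsum]
  refine tsum_congr fun n => ?_
  simp only [ContinuousLinearMap.coe_coe, repr_diagOp b hm, RCLike.inner_apply, map_mul,
    Complex.conj_ofReal]
  ring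

theorem norm_diagOp_le (b : HilbertBasis ι ℂ E) {m : ι → ℝ} (hm : Summable m) {c : ℝ}
    (h0 : 0 ≤ c) (hc : ∀ n, |m n| ≤ c) : ‖diagOp b m‖ ≤ c := by
  refine ContinuousLinearMap.opNorm_le_bound _ h0 fun f => ?_
  rw [← b.repr.norm_map, ← b.repr.norm_map f]
  have h2 : 0 < (2 : ENNReal).toReal := by norm_num
  refine lp.norm_le_of_forall_sum_le h2 (by positivity) fun s => ?_
  calc ∑ n ∈ s, ‖b.repr (diagOp b m f) n‖ ^ (2 : ENNReal).toReal
      ≤ ∑ n ∈ s, c ^ (2 : ENNReal).toReal * ‖b.repr f n‖ ^ (2 : ENNReal).toReal := by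
        refine Finset.sum_le_sum fun n _ => ?_
        rw [← Real.mul_rpow h0 (norm_nonneg _), repr_diagOp b hm, norm_mul, Complex.norm_real]
        exact Real.rpow_le_rpow (by positivity)
          (mul_le_mul_of_nonneg_right (hc n) (norm_nonneg _)) h2.le
    _ ≤ (c * ‖b.repr f‖) ^ (2 : ENNReal).toReal := by
        rw [← Finset.mul_sum, Real.mul_rpow h0 (norm_nonneg _)]
        exact mul_le_mul_of_nonneg_left (lp.sum_rpow_le_norm_rpow h2 _ _) (by positivity)

end Diagonal

theorem Memℓp.of_norm_le {a b : ℤ → ℂ} (hb : Memℓp b 2) {K : ℝ}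
    (h : ∀ n, ‖a n‖ ≤ K * ‖b n‖) : Memℓp a 2 := by
  have hb' := Memℓp.const_smul hb K
  refine memℓp_gen (Summable.of_nonneg_of_le (fun n => by positivity) (fun n => ?_)
    (hb'.summable (by norm_num)))
  refine Real.rpow_le_rpow (norm_nonneg _) ((h n).trans ?_) (by norm_num)
  rw [Pi.smul_apply, norm_smul]
  exact mul_le_mul_of_nonneg_right (le_abs_self K) (norm_nonneg _)

theorem summable_one_div_add_mul_sq {c d : ℝ} (hc : 0 < c) (hd : 0 < d) :
    Summable fun n : ℤ => 1 / (c + d * (n : ℝ) ^ 2) := by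
  have h := (Real.summable_one_div_int_pow (p := 2)).2 one_lt_two
  have h' : Summable fun n : ℤ => 1 / d * (1 / (n : ℝ) ^ 2) := h.mul_left _
  refine Summable.of_norm_bounded_eventually h' ?_
  filter_upwards [(Set.finite_singleton (0 : ℤ)).compl_mem_cofinite] with n hn
  have hn' : (n : ℝ) ≠ 0 := by exact_mod_cast hn
  rw [Real.norm_of_nonneg (by positivity), one_div_mul_one_div]
  exact one_div_le_one_div_of_le (by positivity) (by linarith)

/-! ## Resolvents of Hill operators -/

/-- The eigenvalues of `(C - d²/dx²)⁻¹`. -/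
def freeEig (L C : ℝ) (n : ℤ) : ℝ := 1 / (C + (2 * Real.pi / L) ^ 2 * (n : ℝ) ^ 2)

theorem freeEig_mul (L : ℝ) {C : ℝ} (hC : 0 < C) (n : ℤ) :
    (C + (2 * (Real.pi : ℂ) * n / L) ^ 2) * freeEig L C n = 1 := by
  have h : C + (2 * Real.pi / L) ^ 2 * (n : ℝ) ^ 2 ≠ 0 :=
    (add_pos_of_pos_of_nonneg hC (by positivity)).ne'
  have h2 : (C + (2 * Real.pi / L) ^ 2 * (n : ℝ) ^ 2) * freeEig L C n = 1 := mul_one_div_cancel h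
  rw [← Complex.ofReal_one, ← h2]
  push_cast
  ring

theorem abs_freeEig_le (L : ℝ) {C : ℝ} (hC : 0 < C) (n : ℤ) : |freeEig L C n| ≤ 1 / C := by
  have h : 0 ≤ (2 * Real.pi / L) ^ 2 * (n : ℝ) ^ 2 := by positivity
  rw [freeEig, abs_of_pos (one_div_pos.2 (by linarith))]
  exact one_div_le_one_div_of_le hC (by linarith)

section Hill

variable {L : ℝ} [Fact (0 < L)]

theorem L2per.ext_fourierCoeff {f g : L2per L} (h : ∀ n, fourierCoeff f n = fourierCoeff g n) :
    f = g := by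
  refine fourierBasis.repr.injective (lp.ext (funext fun n => ?_))
  rw [fourierBasis_repr, fourierBasis_repr, h]

theorem fourierCoeff_sub' (f g : L2per L) (n : ℤ) :
    fourierCoeff (f - g : L2per L) n = fourierCoeff f n - fourierCoeff g n := by
  simp only [← fourierBasis_repr, map_sub, lp.coeFn_sub, Pi.sub_apply]

theorem fourierCoeff_smul' (a : ℂ) (f : L2per L) (n : ℤ) :
    fourierCoeff (a • f : L2per L) n = a * fourierCoeff f n := by
  simp only [← fourierBasis_repr, map_smul, lp.coeFn_smul, Pi.smul_apply, smul_eq_mul]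

theorem memℓp_fourierCoeff (f : L2per L) : Memℓp (fun n => fourierCoeff f n) 2 := by
  simpa only [← fourierBasis_repr] using lp.memℓp (fourierBasis.repr f)

theorem fourierCoeff_secondDeriv (f : H2per L) (n : ℤ) :
    fourierCoeff (secondDeriv L f) n =
      -(2 * (Real.pi : ℂ) * n / L) ^ 2 * fourierCoeff (f : L2per L) n := by
  rw [← fourierBasis_repr]
  simp [secondDeriv]

theorem infinite_dimensional_L2per : ¬ FiniteDimensional ℂ (L2per L) := fun h => by
  have := (fourierBasis (T := L)).orthonormal.linearIndependent.finite_of_isNoetherian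
  exact not_finite ℤ

theorem freq_pos : 0 < (2 * Real.pi / L) ^ 2 := by
  have := (Fact.out : 0 < L)
  positivity

theorem summable_freeEig {C : ℝ} (hC : 0 < C) : Summable (freeEig L C) :=
  summable_one_div_add_mul_sq hC freq_pos

/-- The resolvent `(C - d²/dx²)⁻¹`. -/
def freeRes (L : ℝ) [Fact (0 < L)] (C : ℝ) : L2per L →L[ℂ] L2per L :=
  diagOp fourierBasis (freeEig L C)

theorem fourierCoeff_freeRes {C : ℝ} (hC : 0 < C) (f : L2per L) (n : ℤ) :
    fourierCoeff (freeRes L C f) n = freeEig L C n * fourierCoeff f n := by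
  rw [← fourierBasis_repr, ← fourierBasis_repr]
  exact repr_diagOp _ (summable_freeEig hC) _ _

theorem freeRes_mem {C : ℝ} (hC : 0 < C) (f : L2per L) : freeRes L C f ∈ H2per L := by
  have hL := freq_pos (L := L)
  refine Memℓp.of_norm_le (memℓp_fourierCoeff f) (K := 1 / C + 1 / (2 * Real.pi / L) ^ 2)
    fun n => ?_
  rw [fourierCoeff_freeRes hC, ← mul_assoc, norm_mul]
  refine mul_le_mul_of_nonneg_right ?_ (norm_nonneg _)
  have e : (1 + (n : ℂ) ^ 2) * freeEig L C n = (((1 + (n : ℝ) ^ 2) * freeEig L C n : ℝ) : ℂ) := by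
    push_cast; rfl
  have hd : 0 < C + (2 * Real.pi / L) ^ 2 * (n : ℝ) ^ 2 :=
    add_pos_of_pos_of_nonneg hC (by positivity)
  rw [e, Complex.norm_real, freeEig, mul_one_div, Real.norm_of_nonneg (by positivity),
    div_le_iff₀ hd]
  have e2 : (1 / C + 1 / (2 * Real.pi / L) ^ 2) * (C + (2 * Real.pi / L) ^ 2 * (n : ℝ) ^ 2) =
      1 + (n : ℝ) ^ 2 + ((2 * Real.pi / L) ^ 2 * (n : ℝ) ^ 2 / C + C / (2 * Real.pi / L) ^ 2) := by
    generalize (2 * Real.pi / L) ^ 2 = d at *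
    have := hL.ne'
    field_simp
    ring
  rw [e2]
  have : 0 ≤ (2 * Real.pi / L) ^ 2 * (n : ℝ) ^ 2 / C + C / (2 * Real.pi / L) ^ 2 := by positivity
  linarith

theorem secondDeriv_freeRes {C : ℝ} (hC : 0 < C) (f : L2per L) :
    secondDeriv L ⟨freeRes L C f, freeRes_mem hC f⟩ = (C : ℂ) • freeRes L C f - f := by
  refine L2per.ext_fourierCoeff fun n => ?_
  rw [fourierCoeff_secondDeriv, fourierCoeff_sub', fourierCoeff_smul', fourierCoeff_freeRes hC]
  linear_combination (-fourierCoeff f n) * freeEig_mul L hC n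

theorem freeRes_apply {C : ℝ} (hC : 0 < C) (f : H2per L) :
    freeRes L C ((C : ℂ) • (f : L2per L) - secondDeriv L f) = f := by
  refine L2per.ext_fourierCoeff fun n => ?_
  rw [fourierCoeff_freeRes hC, fourierCoeff_sub', fourierCoeff_smul', fourierCoeff_secondDeriv]
  linear_combination (fourierCoeff (f : L2per L) n) * freeEig_mul L hC n

theorem memLp_mul (W : C(AddCircle L, ℂ)) (f : L2per L) :
    MemLp (fun x => W x * f x) 2 (AddCircle.haarAddCircle (T := L)) :=
  MemLp.of_le_mul (c := ‖W‖) (Lp.memLp f)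
    (W.continuous.aestronglyMeasurable.mul (Lp.aestronglyMeasurable f))
    (Eventually.of_forall fun x => by
      rw [norm_mul]
      exact mul_le_mul_of_nonneg_right (W.norm_coe_le_norm x) (norm_nonneg _))

/-- Multiplication by a continuous function on `L²_per`. -/
def mulOp (W : C(AddCircle L, ℂ)) : L2per L →L[ℂ] L2per L :=
  LinearMap.mkContinuous
    { toFun := fun f => (memLp_mul W f).toLp _
      map_add' := fun f g => by
        rw [← MemLp.toLp_add]
        refine MemLp.toLp_congr _ _ ?_
        filter_upwards [Lp.coeFn_add f g] with x hx
        simp only [Pi.add_apply, hx, mul_add]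
      map_smul' := fun a f => by
        rw [RingHom.id_apply, ← MemLp.toLp_const_smul]
        refine MemLp.toLp_congr _ _ ?_
        filter_upwards [Lp.coeFn_smul a f] with x hx
        simp only [Pi.smul_apply, hx, smul_eq_mul]
        ring } ‖W‖ fun f => by
    refine Lp.norm_le_mul_norm_of_ae_le_mul ?_
    filter_upwards [(memLp_mul W f).coeFn_toLp] with x hx
    change ‖(memLp_mul W f).toLp _ x‖ ≤ _
    rw [hx, norm_mul]
    exact mul_le_mul_of_nonneg_right (W.norm_coe_le_norm x) (norm_nonneg _)

theorem mulOp_coe (W : C(AddCircle L, ℂ)) (f : L2per L) :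
    mulOp W f =ᵐ[AddCircle.haarAddCircle] fun x => W x * f x := (memLp_mul W f).coeFn_toLp

theorem norm_mulOp_le (W : C(AddCircle L, ℂ)) : ‖mulOp W‖ ≤ ‖W‖ :=
  LinearMap.mkContinuous_norm_le _ (norm_nonneg _) _

theorem isSymmetric_mulOp {W : C(AddCircle L, ℂ)} (hW : ∀ x, (starRingEnd ℂ) (W x) = W x) :
    (mulOp W : L2per L →ₗ[ℂ] L2per L).IsSymmetric := by
  intro f g
  rw [L2.inner_def, L2.inner_def]
  refine integral_congr_ae ?_
  filter_upwards [mulOp_coe W f, mulOp_coe W g] with x h1 h2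
  simp only [ContinuousLinearMap.coe_coe, h1, h2, RCLike.inner_apply, map_mul, hW]
  ring

/-- The continuous function on the circle given by a continuous periodic function on the line. -/
def perC (u : ℝ → ℂ) (hu : Continuous u) (hp : u.Periodic L) : C(AddCircle L, ℂ) :=
  ⟨AddCircle.liftIco L 0 u, AddCircle.liftIco_zero_continuous (by simpa using (hp 0).symm)
    hu.continuousOn⟩

theorem perC_coe {u : ℝ → ℂ} (hu : Continuous u) (hp : u.Periodic L) (x : ℝ) :
    perC u hu hp (x : AddCircle L) = u x := by
  obtain ⟨y, hy, hxy⟩ : (x : AddCircle L) ∈ ((↑) : ℝ → AddCircle L) '' Set.Ico 0 (0 + L) := by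
    rw [AddCircle.coe_image_Ico_eq]; trivial
  have h : hp.lift (y : AddCircle L) = hp.lift (x : AddCircle L) := by rw [hxy]
  rw [Function.Periodic.lift_coe, Function.Periodic.lift_coe] at h
  rw [← h, ← hxy]
  exact AddCircle.liftIco_coe_apply hy

/-- The continuous function on the circle given by a real potential. -/
abbrev potC (V : ℝ → ℝ) (hV : Continuous V) (hp : V.Periodic L) : C(AddCircle L, ℂ) :=
  perC (fun t => (V t : ℂ)) (by fun_prop) fun t => by dsimp only; rw [hp t]

theorem hillOperator_domain {V : ℝ → ℝ} (hV : Continuous V) (hp : V.Periodic L) :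
    (hillOperator L V).domain = H2per L :=
  le_antisymm (fun _ hf => hf.1) fun f hf => ⟨hf, memLp_mul (potC V hV hp) f⟩

theorem hillOperator_apply {V : ℝ → ℝ} (hV : Continuous V) (hp : V.Periodic L)
    (f : (hillOperator L V).domain) :
    hillOperator L V f = -secondDeriv L ⟨f, f.2.1⟩ + mulOp (potC V hV hp) f := rfl

theorem conj_potC {V : ℝ → ℝ} (hV : Continuous V) (hp : V.Periodic L) (x : AddCircle L) :
    (starRingEnd ℂ) (potC V hV hp x) = potC V hV hp x := by
  induction x using QuotientAddGroup.induction_on with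
  | H t =>
    have h := perC_coe (L := L) (u := fun t => (V t : ℂ)) (by fun_prop)
      (fun t => by dsimp only; rw [hp t]) t
    exact (congrArg _ h).trans ((Complex.conj_ofReal _).trans h.symm)

/-- A Hill operator has compact symmetric resolvents. -/
theorem exists_isShiftedInverse {V : ℝ → ℝ} (hV : Continuous V) (hp : V.Periodic L) {C : ℝ}
    (hC : ‖potC V hV hp‖ + 1 ≤ C) : ∃ G : L2per L →L[ℂ] L2per L, IsCompactOperator G ∧
      (G : L2per L →ₗ[ℂ] L2per L).IsSymmetric ∧ IsShiftedInverse (hillOperator L V) C G := by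
  have hC0 : 0 < C := by linarith [norm_nonneg (potC V hV hp)]
  set B := mulOp (potC V hV hp) with hB
  set R := freeRes L C with hR
  -- With `R = (C - d²/dx²)⁻¹` one has `-d²/dx² + V + C = (1 + B R) R⁻¹`. Since `‖R‖ ≤ 1 / C`, a
  -- Neumann series inverts `U = 1 + B R`, and the resolvent is `R U⁻¹`.
  have hnorm : ‖-(B * R)‖ < 1 := by
    rw [norm_neg]
    calc ‖B * R‖ ≤ ‖B‖ * ‖R‖ := norm_mul_le _ _
      _ ≤ ‖potC V hV hp‖ * (1 / C) :=
          mul_le_mul (norm_mulOp_le _) (norm_diagOp_le _ (summable_freeEig hC0) (by positivity)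
            (abs_freeEig_le L hC0)) (norm_nonneg _) (norm_nonneg _)
      _ < 1 := by rw [mul_one_div, div_lt_one hC0]; linarith
  set U := Units.oneSub _ hnorm
  have hUv : ∀ u, (U : L2per L →L[ℂ] L2per L) u = u + B (R u) := fun u => by
    simp [U, Units.val_oneSub]
  have hU1 : ∀ y, (U : L2per L →L[ℂ] L2per L) ((↑U⁻¹ : L2per L →L[ℂ] L2per L) y) = y := fun y =>
    DFunLike.congr_fun U.mul_inv y
  have hU2 : ∀ y, (↑U⁻¹ : L2per L →L[ℂ] L2per L) ((U : L2per L →L[ℂ] L2per L) y) = y := fun y =>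
    DFunLike.congr_fun U.inv_mul y
  have hRs : (R : L2per L →ₗ[ℂ] L2per L).IsSymmetric := isSymmetric_diagOp _ (summable_freeEig hC0)
  have hBs : (B : L2per L →ₗ[ℂ] L2per L).IsSymmetric := isSymmetric_mulOp (conj_potC hV hp)
  have hRc : IsCompactOperator R := isCompactOperator_diagOp _ (summable_freeEig hC0)
  have hRmem : ∀ u, R u ∈ H2per L := freeRes_mem hC0
  have hR1 : ∀ u, secondDeriv L ⟨R u, hRmem u⟩ = (C : ℂ) • R u - u := secondDeriv_freeRes hC0
  have hR2 : ∀ f : H2per L, R ((C : ℂ) • (f : L2per L) - secondDeriv L f) = f := freeRes_apply hC0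
  have hT := hillOperator_apply hV hp
  rw [← hB] at hT
  have hdom := hillOperator_domain hV hp
  clear_value U R B
  generalize hW : (↑U⁻¹ : L2per L →L[ℂ] L2per L) = W at *
  refine ⟨R ∘L W, hRc.comp_clm _, fun x y => ?_, fun y => ?_, fun x => ?_⟩
  -- After substituting `x = U u`, `y = U v`, symmetry of `R U⁻¹` reduces to symmetry of `R` and of
  -- `B`.
  · obtain ⟨u, rfl⟩ : ∃ u, (U : L2per L →L[ℂ] L2per L) u = x := ⟨_, hU1 x⟩
    obtain ⟨v, rfl⟩ : ∃ v, (U : L2per L →L[ℂ] L2per L) v = y := ⟨_, hU1 y⟩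
    change inner ℂ (R (W _)) _ = inner ℂ _ (R (W _))
    rw [hU2, hU2, hUv, hUv, inner_add_right, inner_add_left]
    exact congrArg₂ _ (hRs u v) (hBs (R u) (R v)).symm
  · have hmem : R (W y) ∈ (hillOperator L V).domain := by
      rw [hdom]; exact hRmem _
    refine ⟨hmem, ?_⟩
    have h1 := hU1 y
    rw [hUv] at h1
    change hillOperator L V ⟨R (W y), hmem⟩ + (C : ℂ) • R (W y) = y
    rw [hT]
    refine Eq.trans ?_ h1
    dsimp only
    rw [hR1 (W y)]
    module
  · have h1 : R ((C : ℂ) • (x : L2per L) - secondDeriv L ⟨x, x.2.1⟩) = x := hR2 ⟨x, x.2.1⟩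
    change R (W (hillOperator L V x + (C : ℂ) • (x : L2per L))) = x
    have h2 : hillOperator L V x + (C : ℂ) • (x : L2per L) = (U : L2per L →L[ℂ] L2per L)
        ((C : ℂ) • (x : L2per L) - secondDeriv L ⟨x, x.2.1⟩) := by
      rw [hUv, h1, hT]
      module
    rw [h2, hU2, h1]

/-- The spectrum of a Hill operator with continuous periodic potential. -/
theorem hillOperator_spectrum {V : ℝ → ℝ} (hV : Continuous V) (hp : V.Periodic L) :
    ∃ ev : ℕ → ℝ, StrictMono ev ∧ Tendsto ev atTop atTop ∧
      pmapSpectrum (hillOperator L V) = Set.range (fun n => (ev n : ℂ)) ∧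
      Set.range ev = {t : ℝ | pmapEigenspace (hillOperator L V) t ≠ ⊥} ∧
      ∀ z, FiniteDimensional ℂ (pmapEigenspace (hillOperator L V) z) :=
  exists_eigenvalue_sequence infinite_dimensional_L2per
    fun _ hC => exists_isShiftedInverse hV hp hC

end Hill

/-! ## Regularity of eigenfunctions -/

theorem periodic_of_hasDerivAt {L : ℝ} {u u' : ℝ → ℂ} (hu : ∀ x, HasDerivAt u (u' x) x)
    (hp : u.Periodic L) : u'.Periodic L := by
  intro x
  have h := (hu (x + L)).comp_add_const x L
  simp only [hp _] at h
  exact h.unique (hu x)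

section Regularity

variable {L : ℝ} [Fact (0 < L)]

/-- The class in `L²_per` of a continuous periodic function. -/
def cls (u : ℝ → ℂ) (hu : Continuous u) (hp : u.Periodic L) : L2per L :=
  ContinuousMap.toLp 2 AddCircle.haarAddCircle ℂ (perC u hu hp)

/-- The `n`-th Fourier coefficient of an `L`-periodic function on the line. -/
def perCoeff (L : ℝ) [Fact (0 < L)] (u : ℝ → ℂ) (n : ℤ) : ℂ :=
  fourierCoeffOn (lt_add_of_pos_right (0 : ℝ) (Fact.out : 0 < L)) u n

theorem fourierCoeff_cls {u : ℝ → ℂ} (hu : Continuous u) (hp : u.Periodic L) (n : ℤ) :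
    fourierCoeff (cls u hu hp) n = perCoeff L u n := by
  rw [cls, fourierCoeff_toLp]
  exact fourierCoeff_liftIco_eq u n

theorem perCoeff_zero (u : ℝ → ℂ) : perCoeff L u 0 = (1 / L : ℂ) * ∫ x in (0 : ℝ)..L, u x := by
  rw [perCoeff, fourierCoeffOn_eq_integral]
  simp

theorem perCoeff_deriv {u u' : ℝ → ℂ} (hu : ∀ x, HasDerivAt u (u' x) x) (hc : Continuous u')
    (hp : u.Periodic L) (n : ℤ) :
    perCoeff L u' n = 2 * Real.pi * Complex.I * n / L * perCoeff L u n := by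
  have hL : (L : ℂ) ≠ 0 := Complex.ofReal_ne_zero.2 (Fact.out : 0 < L).ne'
  rcases eq_or_ne n 0 with rfl | hn
  · rw [perCoeff_zero, intervalIntegral.integral_eq_sub_of_hasDerivAt (fun x _ => hu x)
      (hc.intervalIntegrable _ _)]
    have := hp 0
    rw [zero_add] at this
    simp [this]
  · have h := fourierCoeffOn_of_hasDerivAt (lt_add_of_pos_right (0 : ℝ) (Fact.out : 0 < L)) hn
      (fun x _ => hu x) (hc.intervalIntegrable _ _)
    rw [hp 0, sub_self, mul_zero, zero_sub] at h
    have hn' : (n : ℂ) ≠ 0 := Int.cast_ne_zero.2 hn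
    have hπ : (Real.pi : ℂ) ≠ 0 := Complex.ofReal_ne_zero.2 Real.pi_ne_zero
    have hI := Complex.I_ne_zero
    rw [perCoeff, perCoeff, h]
    push_cast
    field_simp
    ring

theorem perCoeff_deriv_deriv {u u' u'' : ℝ → ℂ} (hu : ∀ x, HasDerivAt u (u' x) x)
    (hu' : ∀ x, HasDerivAt u' (u'' x) x) (hc : Continuous u'') (hp : u.Periodic L)
    (hp' : u'.Periodic L) (n : ℤ) :
    perCoeff L u'' n = -(2 * (Real.pi : ℂ) * n / L) ^ 2 * perCoeff L u n := by
  rw [perCoeff_deriv hu' hc hp', perCoeff_deriv hu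
    (continuous_iff_continuousAt.2 fun x => (hu' x).continuousAt) hp]
  linear_combination ((2 * (Real.pi : ℂ) * n / L) ^ 2 * perCoeff L u n) * Complex.I_sq

/-- The weighted coefficient `(1 + n²) û(n)` is that of `u - (L / 2π)² u''`, hence square summable.
-/
theorem cls_mem_H2per {u u' u'' : ℝ → ℂ} (hu : ∀ x, HasDerivAt u (u' x) x)
    (hu' : ∀ x, HasDerivAt u' (u'' x) x) (hc : Continuous u'') (hc₀ : Continuous u)
    (hp : u.Periodic L) : cls u hc₀ hp ∈ H2per L := by
  have hp' := periodic_of_hasDerivAt hu hp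
  have hp'' := periodic_of_hasDerivAt hu' hp'
  have h1 := memℓp_fourierCoeff (cls u hc₀ hp)
  have h2 := (memℓp_fourierCoeff (cls u'' hc hp'')).const_smul (-(L / (2 * Real.pi)) ^ 2 : ℂ)
  change Memℓp _ 2
  convert! h1.add h2 using 1
  funext n
  simp only [Pi.add_apply, Pi.smul_apply, fourierCoeff_cls,
    perCoeff_deriv_deriv hu hu' hc hp hp', smul_eq_mul]
  have hL : (L : ℂ) ≠ 0 := Complex.ofReal_ne_zero.2 (Fact.out : 0 < L).ne'
  have hπ : (Real.pi : ℂ) ≠ 0 := Complex.ofReal_ne_zero.2 Real.pi_ne_zero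
  field_simp

theorem secondDeriv_cls {u u' u'' : ℝ → ℂ} (hu : ∀ x, HasDerivAt u (u' x) x)
    (hu' : ∀ x, HasDerivAt u' (u'' x) x) (hc : Continuous u'') (hc₀ : Continuous u)
    (hp : u.Periodic L) (hp'' : u''.Periodic L) :
    secondDeriv L ⟨cls u hc₀ hp, cls_mem_H2per hu hu' hc hc₀ hp⟩ = cls u'' hc hp'' := by
  refine L2per.ext_fourierCoeff fun n => ?_
  rw [fourierCoeff_secondDeriv, fourierCoeff_cls, fourierCoeff_cls,
    perCoeff_deriv_deriv hu hu' hc hp (periodic_of_hasDerivAt hu hp)]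

theorem cls_coe {u : ℝ → ℂ} (hu : Continuous u) (hp : u.Periodic L) :
    cls u hu hp =ᵐ[AddCircle.haarAddCircle] perC u hu hp :=
  ContinuousMap.coeFn_toLp _ _

theorem mulOp_cls {q u : ℝ → ℂ} (hq : Continuous q) (hqp : q.Periodic L) (hu : Continuous u)
    (hp : u.Periodic L) :
    mulOp (perC q hq hqp) (cls u hu hp) = cls (fun x => q x * u x) (hq.mul hu) (hqp.mul hp) := by
  refine Lp.ext ?_
  filter_upwards [mulOp_coe (perC q hq hqp) (cls u hu hp), cls_coe hu hp,
    cls_coe (hq.mul hu) (hqp.mul hp)] with x h1 h2 h3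
  rw [h1, h2]
  refine Eq.trans ?_ h3.symm
  induction x using QuotientAddGroup.induction_on with
  | H t =>
    have e1 : perC q hq hqp (t : AddCircle L) * perC u hu hp (t : AddCircle L) = q t * u t := by
      rw [perC_coe, perC_coe]
    exact e1.trans (perC_coe (hq.mul hu) (hqp.mul hp) t).symm

theorem exists_periodic_antideriv {g : ℝ → ℂ} (hg : Continuous g) (hp : g.Periodic L)
    (h0 : ∫ x in (0 : ℝ)..L, g x = 0) :
    ∃ G : ℝ → ℂ, (∀ x, HasDerivAt G (g x) x) ∧ G.Periodic L ∧ ∫ x in (0 : ℝ)..L, G x = 0 := by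
  have hL : (L : ℂ) ≠ 0 := Complex.ofReal_ne_zero.2 (Fact.out : 0 < L).ne'
  have hd : ∀ x, HasDerivAt (fun x => ∫ t in (0 : ℝ)..x, g t) (g x) x := fun x =>
    intervalIntegral.integral_hasDerivAt_right (hg.intervalIntegrable _ _)
      (hg.stronglyMeasurableAtFilter _ _) hg.continuousAt
  have hc : Continuous fun x => ∫ t in (0 : ℝ)..x, g t :=
    continuous_iff_continuousAt.2 fun x => (hd x).continuousAt
  -- Mean zero of `g` makes the primitive periodic; subtracting its own mean allows a second
  -- integration.
  refine ⟨fun x => (∫ t in (0 : ℝ)..x, g t) - (1 / L) * ∫ s in (0 : ℝ)..L, ∫ t in (0 : ℝ)..s, g t,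
    fun x => (hd x).sub_const _, fun x => ?_, ?_⟩
  · have h1 := intervalIntegral.integral_add_adjacent_intervals
      (hg.intervalIntegrable (μ := volume) 0 x) (hg.intervalIntegrable x (x + L))
    have h2 := hp.intervalIntegral_add_eq 0 x
    rw [zero_add, h0] at h2
    rw [← h2, add_zero] at h1
    dsimp only
    rw [h1]
  · rw [intervalIntegral.integral_sub (hc.intervalIntegrable _ _)
      (continuous_const.intervalIntegrable _ _), intervalIntegral.integral_const, sub_zero,
      Complex.real_smul]
    field_simp
    ring

theorem exists_continuous_representative {e : L2per L} (he : e ∈ H2per L) :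
    ∃ h : C(AddCircle L, ℂ), ContinuousMap.toLp 2 AddCircle.haarAddCircle ℂ h = e := by
  have hm : Memℓp (fun n : ℤ => (1 + (n : ℂ) ^ 2) * fourierCoeff e n) 2 := he
  have hs1 := hm.summable (by norm_num)
  have hs2 := summable_one_div_add_mul_sq one_pos one_pos
  have hs : Summable fun n => ‖fourierCoeff e n‖ := by
    refine Summable.of_nonneg_of_le (fun n => norm_nonneg _) (fun n => ?_) (hs1.add hs2)
    have e1 : ‖(1 + (n : ℂ) ^ 2)‖ = 1 + (n : ℝ) ^ 2 := by
      have : (1 + (n : ℂ) ^ 2) = ((1 + (n : ℝ) ^ 2 : ℝ) : ℂ) := by push_cast; ring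
      rw [this, Complex.norm_of_nonneg (by positivity)]
    have e2 : (2 : ENNReal).toReal = ((2 : ℕ) : ℝ) := by norm_num
    rw [norm_mul, e1, e2, Real.rpow_natCast, one_mul]
    have hd : (1 : ℝ) ≤ 1 + (n : ℝ) ^ 2 := by linarith [sq_nonneg (n : ℝ)]
    generalize (1 + (n : ℝ) ^ 2) = d at hd
    -- With `c = ‖ê(n)‖`: either `c ≤ 1 / d`, or `d c ≥ 1` and then `c ≤ d c ≤ (d c)²`. Both bounds
    -- are summable, so the Fourier series converges uniformly.
    rcases le_total (d * ‖fourierCoeff e n‖) 1 with h | h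
    · have h1 : ‖fourierCoeff e n‖ ≤ 1 / d := by rwa [le_div_iff₀' (by linarith)]
      exact h1.trans (le_add_of_nonneg_left (by positivity))
    · have h1 : ‖fourierCoeff e n‖ ≤ d * ‖fourierCoeff e n‖ :=
        le_mul_of_one_le_left (norm_nonneg _) hd
      have h2 : 0 ≤ 1 / d := by positivity
      nlinarith
  have hs' : Summable fun n => fourierCoeff e n • (fourier n : C(AddCircle L, ℂ)) := by
    refine Summable.of_norm ?_
    simpa only [norm_smul, fourier_norm, mul_one] using hs
  refine ⟨∑' n, fourierCoeff e n • (fourier n : C(AddCircle L, ℂ)), ?_⟩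
  have h1 := hs'.hasSum.mapL (ContinuousMap.toLp 2 (AddCircle.haarAddCircle (T := L)) ℂ)
  simp only [map_smul] at h1
  exact h1.unique (hasSum_fourier_series_L2 e)

/-- Solutions `e` of `e'' = q e` in `H²_per` are represented by classical solutions. -/
theorem exists_classical {q : ℝ → ℂ} (hq : Continuous q) (hqp : q.Periodic L) (e : H2per L)
    (he : secondDeriv L e = mulOp (perC q hq hqp) e) :
    ∃ u u' : ℝ → ℂ, ∃ (hu : Continuous u) (hp : u.Periodic L), (∀ x, HasDerivAt u (u' x) x) ∧
      (∀ x, HasDerivAt u' (q x * u x) x) ∧ cls u hu hp = e := by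
  have hL : (L : ℂ) ≠ 0 := Complex.ofReal_ne_zero.2 (Fact.out : 0 < L).ne'
  obtain ⟨h, hh⟩ := exists_continuous_representative e.2
  have hvc : Continuous fun x : ℝ => h (x : AddCircle L) :=
    h.continuous.comp (AddCircle.continuous_mk' L)
  have hvp : Function.Periodic (fun x : ℝ => h (x : AddCircle L)) L := fun x => by
    dsimp only; rw [AddCircle.coe_add_period]
  have hv : cls (fun x : ℝ => h (x : AddCircle L)) hvc hvp = e := by
    rw [← hh, cls]
    congr 1
    ext x
    induction x using QuotientAddGroup.induction_on with
    | H t => exact perC_coe hvc hvp t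
  have hgc : Continuous fun x : ℝ => q x * h (x : AddCircle L) := hq.mul hvc
  have hgp : Function.Periodic (fun x : ℝ => q x * h (x : AddCircle L)) L := hqp.mul hvp
  have hcoef : ∀ n, perCoeff L (fun x : ℝ => q x * h (x : AddCircle L)) n =
      -(2 * (Real.pi : ℂ) * n / L) ^ 2 * fourierCoeff (e : L2per L) n := fun n => by
    rw [← fourierCoeff_secondDeriv, he, ← hv, mulOp_cls hq hqp hvc hvp, fourierCoeff_cls]
  have hg0 : ∫ x in (0 : ℝ)..L, q x * h (x : AddCircle L) = 0 := by
    have h1 := hcoef 0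
    rw [perCoeff_zero] at h1
    simpa [hL] using h1
  -- Integrating `q h` twice gives a `C²` function with the Fourier coefficients of `e` except the
  -- zeroth, which the added constant restores. It therefore equals `h` everywhere.
  obtain ⟨G, hG, hGp, hG0⟩ := exists_periodic_antideriv hgc hgp hg0
  have hGc : Continuous G := continuous_iff_continuousAt.2 fun x => (hG x).continuousAt
  obtain ⟨H, hH, hHp, hH0⟩ := exists_periodic_antideriv hGc hGp hG0
  have hu : ∀ x, HasDerivAt (fun x => H x + fourierCoeff (e : L2per L) 0) (G x) x :=
    fun x => (hH x).add_const _
  have huc : Continuous fun x => H x + fourierCoeff (e : L2per L) 0 :=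
    continuous_iff_continuousAt.2 fun x => (hu x).continuousAt
  have hup : Function.Periodic (fun x => H x + fourierCoeff (e : L2per L) 0) L := fun x => by
    dsimp only; rw [hHp]
  have hcls : cls _ huc hup = (e : L2per L) := by
    refine L2per.ext_fourierCoeff fun n => ?_
    rw [fourierCoeff_cls]
    rcases eq_or_ne n 0 with rfl | hn
    · have hHc : Continuous H := continuous_iff_continuousAt.2 fun x => (hH x).continuousAt
      rw [perCoeff_zero, intervalIntegral.integral_add (hHc.intervalIntegrable _ _)
        (continuous_const.intervalIntegrable _ _), hH0, intervalIntegral.integral_const]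
      simp [hL]
    · have h1 := perCoeff_deriv_deriv hu hG hgc hup hGp n
      rw [hcoef] at h1
      refine (mul_left_cancel₀ ?_ h1).symm
      have hn' : (n : ℂ) ≠ 0 := Int.cast_ne_zero.2 hn
      have hπ : (Real.pi : ℂ) ≠ 0 := Complex.ofReal_ne_zero.2 Real.pi_ne_zero
      rw [neg_ne_zero]
      exact pow_ne_zero 2 (div_ne_zero (mul_ne_zero (mul_ne_zero two_ne_zero hπ) hn') hL)
  have hopen : (AddCircle.haarAddCircle (T := L)).IsOpenPosMeasure := by
    rw [AddCircle.haarAddCircle]; infer_instance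
  have heq : ∀ x, H x + fourierCoeff (e : L2per L) 0 = h (x : AddCircle L) := fun x => by
    have h1 : perC _ huc hup = h := ContinuousMap.toLp_injective (p := 2) (𝕜 := ℂ)
      (AddCircle.haarAddCircle (T := L)) (hcls.trans hh.symm)
    rw [← h1]
    exact (perC_coe huc hup x).symm
  refine ⟨_, G, huc, hup, hu, fun x => ?_, hcls⟩
  rw [heq]
  exact hG x

end Regularity

/-! ## Eigenspaces of Hill operators and periodic solutions -/

section Eigenspaces

variable {L : ℝ} [Fact (0 < L)]

/-- The class in `L²_per` of a real continuous periodic function. -/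
def rcls (y : ℝ → ℝ) (hy : Continuous y) (hp : y.Periodic L) : L2per L :=
  cls (fun t => (y t : ℂ)) (by fun_prop) fun t => by dsimp only; rw [hp t]

theorem isClassOf_rcls {y : ℝ → ℝ} (hy : Continuous y) (hp : y.Periodic L) :
    IsClassOf L (rcls y hy hp) y := cls_coe _ _

theorem cls_injective {u v : ℝ → ℂ} {hu : Continuous u} {hp : u.Periodic L} {hv : Continuous v}
    {hp' : v.Periodic L} (h : cls u hu hp = cls v hv hp') (x : ℝ) : u x = v x := by
  have hopen : (AddCircle.haarAddCircle (T := L)).IsOpenPosMeasure := by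
    rw [AddCircle.haarAddCircle]; infer_instance
  have h1 : perC u hu hp = perC v hv hp' := ContinuousMap.toLp_injective (p := 2) (𝕜 := ℂ)
    (AddCircle.haarAddCircle (T := L)) h
  rw [← perC_coe hu hp, h1, perC_coe]

theorem smul_rcls_add_smul_rcls {y z : ℝ → ℝ} (hy : Continuous y) (hp : y.Periodic L)
    (hz : Continuous z) (hp' : z.Periodic L) (a b : ℂ) :
    a • rcls y hy hp + b • rcls z hz hp' =
      cls (fun x => a * y x + b * z x) (by fun_prop) (fun x => by dsimp only; rw [hp, hp']) := by
  simp only [rcls, cls, ← map_smul, ← map_add]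
  congr 1

theorem rcls_eq_smul {y z : ℝ → ℝ} (hy : Continuous y) (hp : y.Periodic L)
    (hz : Continuous z) (hp' : z.Periodic L) {a : ℝ} (h : ∀ x, z x = a * y x) :
    rcls z hz hp' = (a : ℂ) • rcls y hy hp := by
  have h1 := smul_rcls_add_smul_rcls hy hp hy hp (a : ℂ) 0
  rw [zero_smul, add_zero] at h1
  rw [h1, rcls]
  congr 1
  funext x
  rw [h]
  push_cast
  ring

theorem rcls_eq_combination {y z w : ℝ → ℝ} (hy : Continuous y) (hp : y.Periodic L)
    (hz : Continuous z) (hp' : z.Periodic L) (hw : Continuous w) (hp'' : w.Periodic L) {a b : ℝ}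
    (h : ∀ x, w x = a * y x + b * z x) :
    rcls w hw hp'' = (a : ℂ) • rcls y hy hp + (b : ℂ) • rcls z hz hp' := by
  rw [smul_rcls_add_smul_rcls, rcls]
  congr 1
  funext x
  rw [h]
  push_cast
  ring

theorem rcls_ne_zero {y : ℝ → ℝ} (hy : Continuous y) (hp : y.Periodic L) (hx : ∃ x, y x ≠ 0) :
    rcls y hy hp ≠ 0 := by
  intro h
  obtain ⟨x, hx⟩ := hx
  have h1 := smul_rcls_add_smul_rcls hy hp hy hp 0 0
  rw [zero_smul, add_zero, ← h, rcls] at h1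
  have h2 := cls_injective h1 x
  simp only [zero_mul, add_zero] at h2
  exact hx (Complex.ofReal_eq_zero.1 h2)

variable {V : ℝ → ℝ} {t : ℝ}

theorem rcls_mem_eigenspace (hV : Continuous V) (hp : V.Periodic L) {y y' : ℝ → ℝ}
    (hy : IsSol (fun x => V x - t) y y') (hyp : y.Periodic L) :
    rcls y hy.continuous hyp ∈ pmapEigenspace (hillOperator L V) t := by
  have hyc := hy.continuous
  have hd : ∀ x, HasDerivAt (fun x => (y x : ℂ)) (y' x : ℂ) x := fun x => (hy.1 x).ofReal_comp
  have hd' : ∀ x, HasDerivAt (fun x => (y' x : ℂ)) (((V x - t) * y x : ℝ) : ℂ) x :=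
    fun x => (hy.2 x).ofReal_comp
  have hc : Continuous fun x => (((V x - t) * y x : ℝ) : ℂ) := by fun_prop
  have hc₀ : Continuous fun x => (y x : ℂ) := by fun_prop
  have hpy : Function.Periodic (fun x => (y x : ℂ)) L := fun x => by dsimp only; rw [hyp]
  have hp'' : Function.Periodic (fun x => (((V x - t) * y x : ℝ) : ℂ)) L := fun x => by
    dsimp only; rw [hp, hyp]
  have hmem : rcls y hyc hyp ∈ (hillOperator L V).domain := by
    rw [hillOperator_domain hV hp]
    exact cls_mem_H2per hd hd' hc hc₀ hpy
  refine ⟨hmem, ?_⟩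
  rw [hillOperator_apply hV hp]
  have h1 : secondDeriv L ⟨rcls y hyc hyp, hmem.1⟩ = cls _ hc hp'' :=
    secondDeriv_cls hd hd' hc hc₀ hpy hp''
  dsimp only
  rw [h1, neg_add_eq_iff_eq_add]
  refine (mulOp_cls _ _ hc₀ hpy).trans ?_
  have e1 : cls _ hc hp'' = (1 : ℂ) • rcls (fun x => (V x - t) * y x) (by fun_prop)
    (fun x => by dsimp only; rw [hp, hyp]) := (one_smul _ _).symm
  rw [e1]
  refine Eq.trans ?_ (smul_rcls_add_smul_rcls _ _ _ _ _ _).symm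
  congr 1
  funext x
  push_cast
  ring

/-- The potential and `t` are real, so the real and imaginary parts of the classical representative
solve the equation separately. -/
theorem exists_isSol_of_mem_eigenspace (hV : Continuous V) (hp : V.Periodic L) {e : L2per L}
    (he : e ∈ pmapEigenspace (hillOperator L V) t) :
    ∃ y y' z z' : ℝ → ℝ, ∃ (hy : IsSol (fun x => V x - t) y y')
      (hz : IsSol (fun x => V x - t) z z') (hyp : y.Periodic L) (hzp : z.Periodic L),
      e = (1 : ℂ) • rcls y hy.continuous hyp + Complex.I • rcls z hz.continuous hzp := by
  obtain ⟨hd, h⟩ := he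
  rw [hillOperator_apply hV hp, neg_add_eq_iff_eq_add] at h
  have hqc : Continuous fun x => ((V x - t : ℝ) : ℂ) := by fun_prop
  have hqp : Function.Periodic (fun x => ((V x - t : ℝ) : ℂ)) L := fun x => by
    dsimp only; rw [hp]
  have h1 : secondDeriv L ⟨e, hd.1⟩ = mulOp (perC _ hqc hqp) e := by
    have h2 : secondDeriv L ⟨e, hd.1⟩ = mulOp (potC V hV hp) e - (t : ℂ) • e :=
      eq_sub_of_add_eq h.symm
    rw [h2]
    refine Lp.ext ?_
    filter_upwards [Lp.coeFn_sub (mulOp (potC V hV hp) e) ((t : ℂ) • e), Lp.coeFn_smul (t : ℂ) e,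
      mulOp_coe (potC V hV hp) e, mulOp_coe (perC _ hqc hqp) e] with x h3 h4 h5 h6
    rw [h3, Pi.sub_apply, h4, h5, h6, Pi.smul_apply, smul_eq_mul, ← sub_mul]
    congr 1
    induction x using QuotientAddGroup.induction_on with
    | H x =>
      have h7 := perC_coe (L := L) (u := fun x => (V x : ℂ)) (by fun_prop)
        (fun t => by dsimp only; rw [hp t]) x
      have h8 := perC_coe hqc hqp x
      refine (congrArg (fun v => v - (t : ℂ)) h7).trans (Eq.trans ?_ h8.symm)
      push_cast
      rfl
  obtain ⟨u, u', huc, hup, hu, hu', hcls⟩ := exists_classical hqc hqp ⟨e, hd.1⟩ h1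
  have hre : ∀ {f f' : ℝ → ℂ}, (∀ x, HasDerivAt f (f' x) x) →
      ∀ x, HasDerivAt (fun x => (f x).re) (f' x).re x := fun hf x =>
    (Complex.reCLM.hasFDerivAt.comp_hasDerivAt x (hf x))
  have him : ∀ {f f' : ℝ → ℂ}, (∀ x, HasDerivAt f (f' x) x) →
      ∀ x, HasDerivAt (fun x => (f x).im) (f' x).im x := fun hf x =>
    (Complex.imCLM.hasFDerivAt.comp_hasDerivAt x (hf x))
  refine ⟨fun x => (u x).re, fun x => (u' x).re, fun x => (u x).im, fun x => (u' x).im,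
    ⟨hre hu, fun x => ?_⟩, ⟨him hu, fun x => ?_⟩, fun x => by dsimp only; rw [hup],
    fun x => by dsimp only; rw [hup], ?_⟩
  · simpa using hre hu' x
  · simpa using him hu' x
  · refine hcls.symm.trans (Eq.trans ?_ (smul_rcls_add_smul_rcls _ _ _ _ _ _).symm)
    congr 1
    funext x
    rw [one_mul, mul_comm, Complex.re_add_im]

theorem exists_isSol_of_eigenspace_ne_bot (hV : Continuous V) (hp : V.Periodic L)
    (he : pmapEigenspace (hillOperator L V) t ≠ ⊥) :
    ∃ y y' : ℝ → ℝ, IsSol (fun x => V x - t) y y' ∧ (∃ x, y x ≠ 0) ∧ y.Periodic L := by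
  obtain ⟨e, he, hne⟩ := Submodule.exists_mem_ne_zero_of_ne_bot he
  obtain ⟨y, y', z, z', hy, hz, hyp, hzp, rfl⟩ := exists_isSol_of_mem_eigenspace hV hp he
  by_cases h1 : ∃ x, y x ≠ 0
  · exact ⟨y, y', hy, h1, hyp⟩
  by_cases h2 : ∃ x, z x ≠ 0
  · exact ⟨z, z', hz, h2, hzp⟩
  push Not at h1 h2
  refine absurd ?_ hne
  rw [rcls_eq_smul hy.continuous hyp hy.continuous hyp (a := 0) (fun x => by simp [h1]),
    rcls_eq_smul hz.continuous hzp hz.continuous hzp (a := 0) (fun x => by simp [h2])]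
  simp

theorem eigenspace_eq_span (hV : Continuous V) (hp : V.Periodic L) {y y' : ℝ → ℝ}
    (hy : IsSol (fun x => V x - t) y y') (hyp : y.Periodic L)
    (h : ∀ w w', IsSol (fun x => V x - t) w w' → w.Periodic L → ∃ a : ℝ, ∀ x, w x = a * y x) :
    pmapEigenspace (hillOperator L V) t = Submodule.span ℂ {rcls y hy.continuous hyp} := by
  refine le_antisymm (fun e he => ?_) ?_
  · obtain ⟨u, u', v, v', hu, hv, hup, hvp, rfl⟩ := exists_isSol_of_mem_eigenspace hV hp he
    obtain ⟨a, ha⟩ := h u u' hu hup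
    obtain ⟨b, hb⟩ := h v v' hv hvp
    rw [rcls_eq_smul hy.continuous hyp hu.continuous hup ha,
      rcls_eq_smul hy.continuous hyp hv.continuous hvp hb]
    have hmem := Submodule.mem_span_singleton_self (R := ℂ) (rcls y hy.continuous hyp)
    exact Submodule.add_mem _ (Submodule.smul_mem _ _ (Submodule.smul_mem _ _ hmem))
      (Submodule.smul_mem _ _ (Submodule.smul_mem _ _ hmem))
  · rw [Submodule.span_singleton_le_iff_mem]
    exact rcls_mem_eigenspace hV hp hy hyp

theorem finrank_eigenspace_eq_one (hV : Continuous V) (hp : V.Periodic L) {y y' : ℝ → ℝ}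
    (hy : IsSol (fun x => V x - t) y y') (hyp : y.Periodic L) (hx : ∃ x, y x ≠ 0)
    (h : ∀ w w', IsSol (fun x => V x - t) w w' → w.Periodic L → ∃ a : ℝ, ∀ x, w x = a * y x) :
    Module.finrank ℂ (pmapEigenspace (hillOperator L V) t) = 1 := by
  rw [eigenspace_eq_span hV hp hy hyp h]
  exact finrank_span_singleton (rcls_ne_zero hy.continuous hyp hx)

theorem finrank_eigenspace_eq_two (hV : Continuous V) (hp : V.Periodic L) {Q : ℝ}
    (hQ : ∀ x, |V x - t| ≤ Q) {y y' : ℝ → ℝ} (hy : IsSol (fun x => V x - t) y y')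
    (hx : ∃ x, y x ≠ 0) (h : ∀ w w', IsSol (fun x => V x - t) w w' → w.Periodic L) :
    Module.finrank ℂ (pmapEigenspace (hillOperator L V) t) = 2 := by
  obtain ⟨z, z', x₀, hz, hne⟩ := IsSol.exists_wronskian_ne_zero (u' := y')
    (hV.sub continuous_const) hQ hx
  have hyp := h _ _ hy
  have hzp := h _ _ hz
  set b : Fin 2 → L2per L := ![rcls y hy.continuous hyp, rcls z hz.continuous hzp] with hb
  have hspan : pmapEigenspace (hillOperator L V) t = Submodule.span ℂ (Set.range b) := by
    have hr : Set.range b = {rcls y hy.continuous hyp, rcls z hz.continuous hzp} := by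
      rw [hb, Matrix.range_cons, Matrix.range_cons, Matrix.range_empty, Set.union_empty]; rfl
    rw [hr]
    refine le_antisymm (fun e he => ?_) (Submodule.span_le.2 ?_)
    · obtain ⟨u, u', v, v', hu, hv, hup, hvp, rfl⟩ := exists_isSol_of_mem_eigenspace hV hp he
      obtain ⟨a₁, a₂, ha, -⟩ := hy.eq_combination hz hu hne
      obtain ⟨b₁, b₂, hb, -⟩ := hy.eq_combination hz hv hne
      rw [rcls_eq_combination hy.continuous hyp hz.continuous hzp hu.continuous hup ha,
        rcls_eq_combination hy.continuous hyp hz.continuous hzp hv.continuous hvp hb]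
      have h1 : rcls y hy.continuous hyp ∈
          Submodule.span ℂ {rcls y hy.continuous hyp, rcls z hz.continuous hzp} :=
        Submodule.subset_span (Or.inl rfl)
      have h2 : rcls z hz.continuous hzp ∈
          Submodule.span ℂ {rcls y hy.continuous hyp, rcls z hz.continuous hzp} :=
        Submodule.subset_span (Or.inr rfl)
      exact Submodule.add_mem _
        (Submodule.smul_mem _ _ (Submodule.add_mem _ (Submodule.smul_mem _ _ h1)
          (Submodule.smul_mem _ _ h2)))
        (Submodule.smul_mem _ _ (Submodule.add_mem _ (Submodule.smul_mem _ _ h1)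
          (Submodule.smul_mem _ _ h2)))
    · rintro _ (rfl | rfl)
      · exact rcls_mem_eigenspace hV hp hy hyp
      · exact rcls_mem_eigenspace hV hp hz hzp
  have hli : LinearIndependent ℂ b := by
    rw [hb, LinearIndependent.pair_iff]
    intro a c hac
    rw [smul_rcls_add_smul_rcls] at hac
    have h0 := smul_rcls_add_smul_rcls hy.continuous hyp hy.continuous hyp 0 0
    rw [zero_smul, add_zero, ← hac] at h0
    have h1 : ∀ x, a * (y x : ℂ) + c * z x = 0 := fun x => by
      have := cls_injective h0 x
      simpa using this
    -- Differentiating the linear relation gives a second equation; the determinant of the system is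
    -- the nonzero Wronskian.
    have h2 : a * (y' x₀ : ℂ) + c * z' x₀ = 0 := by
      have h3 := ((hy.1 x₀).ofReal_comp.const_mul a).add ((hz.1 x₀).ofReal_comp.const_mul c)
      refine h3.unique ?_
      have h4 : (((fun x => a * (y x : ℂ)) + fun x => c * (z x : ℂ)) : ℝ → ℂ) = fun _ => 0 :=
        funext h1
      rw [h4]
      exact hasDerivAt_const _ _
    have hne' : ((y x₀ : ℂ) * z' x₀ - y' x₀ * z x₀) ≠ 0 := by exact_mod_cast hne
    constructor
    · refine (mul_eq_zero.1 ?_).resolve_right hne'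
      linear_combination (z' x₀ : ℂ) * h1 x₀ - (z x₀ : ℂ) * h2
    · refine (mul_eq_zero.1 ?_).resolve_right hne'
      linear_combination (y x₀ : ℂ) * h2 - (y' x₀ : ℂ) * h1 x₀
  rw [hspan, finrank_span_eq_card hli, Fintype.card_fin]

end Eigenspaces

/-! ## The dnoidal waves -/

theorem StrictMono.first_eq {ev : ℕ → ℝ} (hev : StrictMono ev) {a : ℝ} (ha : a ∈ Set.range ev)
    (h : ∀ t ∈ Set.range ev, a ≤ t) : ev 0 = a := by
  obtain ⟨i, rfl⟩ := ha
  exact le_antisymm (hev.monotone (Nat.zero_le i)) (h _ ⟨0, rfl⟩)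

theorem StrictMono.first_three_eq {ev : ℕ → ℝ} (hev : StrictMono ev) {a b c : ℝ} (hab : a < b)
    (hbc : b < c) (ha : a ∈ Set.range ev) (hb : b ∈ Set.range ev) (hc : c ∈ Set.range ev)
    (h : ∀ t ∈ Set.range ev, t = a ∨ t = b ∨ t = c ∨ c < t) :
    ev 0 = a ∧ ev 1 = b ∧ ev 2 = c := by
  have h0 : ev 0 = a := hev.first_eq ha fun t ht => by
    rcases h t ht with h | h | h | h <;> linarith
  have h1 : ev 1 = b := by
    obtain ⟨j, rfl⟩ := hb
    have hj : 1 ≤ j := by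
      by_contra hn
      have : j = 0 := by omega
      subst this
      linarith
    have h2 := hev.monotone hj
    have h3 := hev (show 0 < 1 from one_pos)
    rcases h _ ⟨1, rfl⟩ with h | h | h | h <;> linarith
  refine ⟨h0, h1, ?_⟩
  obtain ⟨j, rfl⟩ := hc
  have hj : 2 ≤ j := by
    by_contra hn
    have : j = 0 ∨ j = 1 := by omega
    rcases this with rfl | rfl <;> linarith
  have h2 := hev.monotone hj
  have h3 := hev (show 1 < 2 from one_lt_two)
  rcases h _ ⟨2, rfl⟩ with h | h | h | h <;> linarith

/-- The period condition is `s L = 2 K(k)` for `s = η₁ / √(2 (1 - c²))`, and `0 < η₂ < η₁` means `0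
< k² < 1`. -/
theorem dnoidal_jacobiTriple {L c η₁ η₂ : ℝ} (hL0 : 0 < L) (hc : 0 < 1 - c ^ 2) (hη₂ : 0 < η₂)
    (hη : η₂ < η₁) (hL : dnoidalPeriod c η₁ η₂ = L) :
    ∃ S C, JacobiTriple L (η₁ / √(2 * (1 - c ^ 2))) ((η₁ ^ 2 - η₂ ^ 2) / η₁ ^ 2) S C
      fun x => jacobiDn (η₁ / √(2 * (1 - c ^ 2)) * x) (dnoidalModulus η₁ η₂) := by
  have hη₁ : 0 < η₁ := hη₂.trans hη
  have hr : 0 < √(2 * (1 - c ^ 2)) := Real.sqrt_pos.2 (by linarith)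
  have h0 : 0 < (η₁ ^ 2 - η₂ ^ 2) / η₁ ^ 2 := div_pos (by nlinarith) (by positivity)
  have h1 : (η₁ ^ 2 - η₂ ^ 2) / η₁ ^ 2 < 1 := by
    rw [div_lt_one (by positivity)]; nlinarith
  have hk : dnoidalModulus η₁ η₂ ^ 2 = (η₁ ^ 2 - η₂ ^ 2) / η₁ ^ 2 := Real.sq_sqrt h0.le
  rw [← hk]
  refine ⟨_, _, jacobiTriple (Real.sqrt_pos.2 h0) (by rw [hk]; exact h1) (by positivity) hL0 ?_⟩
  rw [← hL, dnoidalPeriod]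
  field_simp

theorem JacobiTriple.continuous_D {L s κ : ℝ} {S C D : ℝ → ℝ} (h : JacobiTriple L s κ S C D) :
    Continuous D :=
  continuous_iff_continuousAt.2 fun x => (h.deriv_D x).continuousAt

/-! ### Periodic spectra of the two Lamé operators -/

section Dnoidal

variable {L s κ η : ℝ} [Fact (0 < L)] {S C D V : ℝ → ℝ}

namespace JacobiTriple

/-- The eigenvalues of the Lamé operator `-d²/dx² + s² (2 - κ) - 6 s² dn²`. -/
theorem lame_spectrum (h : JacobiTriple L s κ S C D)
    (hV : ∀ x, V x = s ^ 2 * (2 - κ) - 6 * s ^ 2 * D x ^ 2) (hη : η ≠ 0) :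
    (hillOperator L V).domain = H2per L ∧
      ∃ ev : ℕ → ℝ, StrictMono ev ∧ Tendsto ev atTop atTop ∧
        pmapSpectrum (hillOperator L V) = Set.range (fun n => (ev n : ℂ)) ∧
        (∀ n, n < 3 → Module.finrank ℂ (pmapEigenspace (hillOperator L V) (ev n)) = 1) ∧
        (∀ n, 3 ≤ n → Module.finrank ℂ (pmapEigenspace (hillOperator L V) (ev n)) = 2) ∧
        ev 1 = 0 ∧
        ∃ e : L2per L, IsClassOf L e (deriv fun x => η * D x) ∧
          pmapEigenspace (hillOperator L V) 0 = Submodule.span ℂ {e} := by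
  have hDc := h.continuous_D
  have hs := h.pos_s
  have hκ := h.pos_κ
  have hVc : Continuous V := by
    rw [funext hV]; fun_prop
  have hVp : V.Periodic L := fun x => by rw [hV, hV, h.D_add]
  -- `V - t` in terms of the Lamé parameter
  have hq : ∀ t, (fun x => V x - t) = lameQ s κ S (4 + κ + t / s ^ 2) := fun t => by
    funext x
    rw [hV, lameQ, h.D_sq]
    field_simp
    ring
  have hpar : ∀ {t m}, 4 + κ + t / s ^ 2 = m ↔ t = s ^ 2 * (m - 4 - κ) := fun {t m} => by
    constructor
    · rintro rfl; field_simp; ring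
    · rintro rfl; field_simp; ring
  obtain ⟨hlt1, hlt2⟩ := edge_lt hκ h.lt_one
  -- `a < 0 < b` are the eigenvalues `t` of the two edges `1 - a' sn²`; the edge `4 + κ` is `t = 0`.
  set a := s ^ 2 * (2 * edge κ (-1) - 4 - κ) with ha
  set b := s ^ 2 * (2 * edge κ 1 - 4 - κ) with hb
  have ha0 : a < 0 := mul_neg_of_pos_of_neg (by positivity) (by linarith)
  have hb0 : 0 < b := mul_pos (by positivity) (by linarith)
  have hSC : ∃ x, S x * C x ≠ 0 := by
    by_contra! hn
    have h1 := h.isSol_SC.1 0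
    rw [funext hn] at h1
    have h2 := h1.unique (hasDerivAt_const 0 0)
    simp only [h.S_zero] at h2
    have := mul_pos hs (h.pos_D 0)
    linarith
  -- the three simple eigenvalues
  have hsimple : ∀ {t y y'}, IsSol (lameQ s κ S (4 + κ + t / s ^ 2)) y y' → t ≤ b →
      (∃ x, y x ≠ 0) → y.Periodic L → ∀ w w', IsSol (fun x => V x - t) w w' → w.Periodic L →
      ∃ a : ℝ, ∀ x, w x = a * y x := by
    intro t y y' hy ht hx hyp w w' hw hwp
    rw [hq] at hw
    refine h.exists_mul_of_periodic ?_ hy hx hyp hw hwp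
    have h1 : t / s ^ 2 ≤ 2 * edge κ 1 - 4 - κ := by
      rw [div_le_iff₀ (by positivity)]; linarith
    linarith
  have hquad : ∀ {ε : ℝ}, ε ^ 2 = 1 → ∃ y y', IsSol (lameQ s κ S (2 * edge κ ε)) y y' ∧
      (∃ x, y x ≠ 0) ∧ y.Periodic L := fun {ε} hε =>
    ⟨_, _, h.isSol_quadratic (edge_eq κ hε), ⟨0, by simp [h.S_zero]⟩, fun x => by
      dsimp only; rw [h.S_sq_periodic]⟩
  have hex : ∀ t, t = a ∨ t = 0 ∨ t = b → ∃ y y', IsSol (lameQ s κ S (4 + κ + t / s ^ 2)) y y' ∧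
      (∃ x, y x ≠ 0) ∧ y.Periodic L := by
    rintro t (rfl | rfl | rfl)
    · rw [hpar.2 ha]; exact hquad (by norm_num)
    · rw [zero_div, add_zero]
      exact ⟨_, _, h.isSol_SC, hSC, fun x => by dsimp only; rw [h.S_add, h.C_add, neg_mul_neg]⟩
    · rw [hpar.2 hb]; exact hquad (by norm_num)
  have hle : ∀ t, t = a ∨ t = 0 ∨ t = b → t ≤ b := by
    rintro t (rfl | rfl | rfl) <;> linarith
  have hone : ∀ t, t = a ∨ t = 0 ∨ t = b →
      Module.finrank ℂ (pmapEigenspace (hillOperator L V) (t : ℂ)) = 1 := by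
    intro t ht
    obtain ⟨y, y', hy, hx, hyp⟩ := hex t ht
    exact finrank_eigenspace_eq_one hVc hVp (by rw [hq]; exact hy) hyp hx
      (hsimple hy (hle t ht) hx hyp)
  obtain ⟨ev, hmono, htend, hspec, hrange, -⟩ := hillOperator_spectrum (L := L) hVc hVp
  have hmem : ∀ t, t = a ∨ t = 0 ∨ t = b → t ∈ Set.range ev := by
    intro t ht
    rw [hrange]
    intro hbot
    have h1 := hone t ht
    rw [hbot, finrank_bot] at h1
    exact zero_ne_one h1
  have hdouble : ∀ t ∈ Set.range ev, ¬(t = a ∨ t = 0 ∨ t = b) →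
      b < t ∧ Module.finrank ℂ (pmapEigenspace (hillOperator L V) (t : ℂ)) = 2 := by
    intro t ht hnt
    rw [hrange] at ht
    push Not at hnt
    obtain ⟨y, y', hy, hx, hyp⟩ := exists_isSol_of_eigenspace_ne_bot hVc hVp ht
    have hy' := hy
    rw [hq] at hy'
    obtain ⟨h1, h2⟩ := h.double_of_ne (fun h3 => hnt.1 (hpar.1 h3))
      (fun h3 => hnt.2.1 (by rw [hpar.1 h3]; ring)) (fun h3 => hnt.2.2 (hpar.1 h3)) hy' hx hyp
    refine ⟨?_, finrank_eigenspace_eq_two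
      (Q := s ^ 2 * (6 * κ + |4 + κ + t / s ^ 2|)) hVc hVp (fun x => ?_) hy hx fun w w' hw => h2 w w' (by rwa [← hq])⟩
    · have h3 : 2 * edge κ 1 - 4 - κ < t / s ^ 2 := by linarith
      rw [lt_div_iff₀ (by positivity)] at h3
      linarith
    · exact (congrArg abs (congrFun (hq t) x)).trans_le (h.lameQ_bound _ x)
  obtain ⟨e0, e1, e2⟩ := hmono.first_three_eq ha0 hb0 (hmem a (by simp)) (hmem 0 (by simp))
    (hmem b (by simp)) fun t ht => by
      by_cases hnt : t = a ∨ t = 0 ∨ t = b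
      · tauto
      · exact Or.inr (Or.inr (Or.inr (hdouble t ht hnt).1))
  refine ⟨hillOperator_domain hVc hVp, ev, hmono, htend, hspec, fun n hn => ?_, fun n hn => ?_,
    e1, ?_⟩
  · refine hone _ ?_
    interval_cases n <;> simp [*]
  · refine (hdouble _ ⟨n, rfl⟩ ?_).2
    have h1 := hmono (show 2 < n from hn)
    rw [e2] at h1
    rintro (h2 | h2 | h2) <;> linarith
  · have hderiv : (deriv fun x => η * D x) = fun x => -(η * s * κ) * (S x * C x) := by
      funext x
      rw [((h.deriv_D x).const_mul η).deriv]
      ring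
    have hsol := h.isSol_SC.const_mul (-(η * s * κ))
    have hp : Function.Periodic (fun x => -(η * s * κ) * (S x * C x)) L := fun x => by
      dsimp only; rw [h.S_add, h.C_add, neg_mul_neg]
    have hsol' := hsol
    rw [show 4 + κ = 4 + κ + 0 / s ^ 2 by rw [zero_div, add_zero]] at hsol'
    refine ⟨rcls _ hsol.continuous hp, by rw [hderiv]; exact isClassOf_rcls _ _, ?_⟩
    have hne : ∃ x, -(η * s * κ) * (S x * C x) ≠ 0 := by
      obtain ⟨x, hx⟩ := hSC
      exact ⟨x, mul_ne_zero (neg_ne_zero.2 (mul_ne_zero (mul_ne_zero hη hs.ne') hκ.ne')) hx⟩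
    have h1 := eigenspace_eq_span hVc hVp (t := 0) (by rw [hq]; exact hsol') hp
      (hsimple hsol' hb0.le hne hp)
    rwa [Complex.ofReal_zero] at h1

/-- The eigenvalues of the Lamé operator `-d²/dx² + s² (2 - κ) - 2 s² dn²`. -/
theorem lame_one_spectrum (h : JacobiTriple L s κ S C D)
    (hV : ∀ x, V x = s ^ 2 * (2 - κ) - 2 * s ^ 2 * D x ^ 2) (hη : 0 < η) :
    (hillOperator L V).domain = H2per L ∧
      ∃ ev : ℕ → ℝ, StrictMono ev ∧ Tendsto ev atTop atTop ∧
        pmapSpectrum (hillOperator L V) = Set.range (fun n => (ev n : ℂ)) ∧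
        (∀ n, 0 < Module.finrank ℂ (pmapEigenspace (hillOperator L V) (ev n))) ∧
        ev 0 = 0 ∧
        Module.finrank ℂ (pmapEigenspace (hillOperator L V) 0) = 1 ∧
        ∃ e : L2per L, IsClassOf L e (fun x => η * D x) ∧
          pmapEigenspace (hillOperator L V) 0 = Submodule.span ℂ {e} := by
  have hDc := h.continuous_D
  have hVc : Continuous V := by
    rw [funext hV]; fun_prop
  have hVp : V.Periodic L := fun x => by rw [hV, hV, h.D_add]
  have hsol : IsSol V (fun x => η * D x) (fun x => η * -(s * κ * (S x * C x))) := by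
    have h1 := h.isSol_D.const_mul η
    rwa [← funext hV] at h1
  have hpos : ∀ x, 0 < η * D x := fun x => mul_pos hη (h.pos_D x)
  have hp : Function.Periodic (fun x => η * D x) L := fun x => by dsimp only; rw [h.D_add]
  have hsol' : IsSol (fun x => V x - 0) (fun x => η * D x)
      (fun x => η * -(s * κ * (S x * C x))) := by
    simp only [sub_zero]; exact hsol
  have hbound : ∀ x, |V x| ≤ |s ^ 2 * (2 - κ)| + 2 * s ^ 2 := fun x => by
    rw [hV]
    refine (abs_sub _ _).trans (add_le_add_right ?_ _)
    rw [abs_of_nonneg (by positivity), h.D_sq]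
    nlinarith [mul_nonneg (sq_nonneg s) (mul_nonneg h.pos_κ.le (sq_nonneg (S x)))]
  have hmul : ∀ w w', IsSol (fun x => V x - 0) w w' → w.Periodic L →
      ∃ a : ℝ, ∀ x, w x = a * (η * D x) := by
    intro w w' hw hwp
    have h1 := hsol.wronskian_eq_zero_of_pos (Fact.out : 0 < L) hp hpos hw hwp le_rfl 0
    simp only [sub_zero] at hw
    -- Comparison with the positive solution at `t = 0` kills the Wronskian, so `w` is proportional
    -- to the wave.
    obtain ⟨a, h2, -⟩ := hsol.eq_mul_of_wronskian_eq_zero hVc hbound ⟨0, (hpos 0).ne'⟩ hw h1.1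
    exact ⟨a, h2⟩
  have hone := finrank_eigenspace_eq_one hVc hVp hsol' hp ⟨0, (hpos 0).ne'⟩ hmul
  have hspan := eigenspace_eq_span hVc hVp hsol' hp hmul
  obtain ⟨ev, hmono, htend, hspec, hrange, hfd⟩ := hillOperator_spectrum (L := L) hVc hVp
  have h0 : ev 0 = 0 := by
    refine hmono.first_eq ?_ fun t ht => ?_
    · rw [hrange]
      intro hbot
      rw [hbot, finrank_bot] at hone
      exact zero_ne_one hone
    · rw [hrange] at ht
      obtain ⟨y, y', hy, ⟨x, hx⟩, hyp⟩ := exists_isSol_of_eigenspace_ne_bot hVc hVp ht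
      by_contra hn
      have h1 := (hsol.wronskian_eq_zero_of_pos (Fact.out : 0 < L) hp hpos hy hyp
        (not_le.1 hn).le x).2
      rcases mul_eq_zero.1 h1 with h2 | h2
      · exact hn h2.ge
      · exact hx (pow_eq_zero_iff two_ne_zero |>.1 h2)
  rw [Complex.ofReal_zero] at hone hspan
  refine ⟨hillOperator_domain hVc hVp, ev, hmono, htend, hspec, fun n => ?_, h0, hone, _,
    isClassOf_rcls _ _, hspan⟩
  have hne : pmapEigenspace (hillOperator L V) (ev n) ≠ ⊥ := by
    have : ev n ∈ {t : ℝ | pmapEigenspace (hillOperator L V) t ≠ ⊥} := hrange ▸ ⟨n, rfl⟩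
    exact this
  have := hfd (ev n)
  rw [Module.finrank_pos_iff]
  exact Submodule.nontrivial_iff_ne_bot.2 hne

end JacobiTriple

end Dnoidal

end

end

theorem mainTheorem3 (L : ℝ) [Fact (0 < L)] (ω c η₁ η₂ : ℝ)
    (hc : 0 < 1 - c ^ 2)
    (hν : 2 * Real.pi ^ 2 / L ^ 2 < -(ω + c ^ 2 / 4))
    (hη₂ : 0 < η₂) (hη : η₂ < η₁)
    (hsum : η₁ ^ 2 + η₂ ^ 2 = 2 * -(ω + c ^ 2 / 4) * (1 - c ^ 2))
    (hL : dnoidalPeriod c η₁ η₂ = L) :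
    -- the operator 𝓛₃
    ((operatorL3 L ω c η₁ η₂).domain = H2per L ∧
      ∃ ev : ℕ → ℝ, StrictMono ev ∧ Tendsto ev atTop atTop ∧
        pmapSpectrum (operatorL3 L ω c η₁ η₂) = Set.range (fun n => (ev n : ℂ)) ∧
        (∀ n, n < 3 →
          Module.finrank ℂ (pmapEigenspace (operatorL3 L ω c η₁ η₂) (ev n)) = 1) ∧
        (∀ n, 3 ≤ n →
          Module.finrank ℂ (pmapEigenspace (operatorL3 L ω c η₁ η₂) (ev n)) = 2) ∧
        ev 1 = 0 ∧
        ∃ e : L2per L, IsClassOf L e (deriv (dnoidalPhi c η₁ η₂)) ∧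
          pmapEigenspace (operatorL3 L ω c η₁ η₂) 0 = Submodule.span ℂ {e}) ∧
    -- the operator 𝓛₄
    ((operatorL4 L ω c η₁ η₂).domain = H2per L ∧
      ∃ ev : ℕ → ℝ, StrictMono ev ∧ Tendsto ev atTop atTop ∧
        pmapSpectrum (operatorL4 L ω c η₁ η₂) = Set.range (fun n => (ev n : ℂ)) ∧
        (∀ n, 0 < Module.finrank ℂ (pmapEigenspace (operatorL4 L ω c η₁ η₂) (ev n))) ∧
        ev 0 = 0 ∧
        Module.finrank ℂ (pmapEigenspace (operatorL4 L ω c η₁ η₂) 0) = 1 ∧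
        ∃ e : L2per L, IsClassOf L e (dnoidalPhi c η₁ η₂) ∧
          pmapEigenspace (operatorL4 L ω c η₁ η₂) 0 = Submodule.span ℂ {e}) := by
  have hη₁ : 0 < η₁ := hη₂.trans hη
  obtain ⟨S, C, h⟩ := dnoidal_jacobiTriple (Fact.out : 0 < L) hc hη₂ hη hL
  have hsq : √(2 * (1 - c ^ 2)) ^ 2 = 2 * (1 - c ^ 2) := Real.sq_sqrt (by linarith)
  have hs : (η₁ / √(2 * (1 - c ^ 2))) ^ 2 = η₁ ^ 2 / (2 * (1 - c ^ 2)) := by rw [div_pow, hsq]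
  -- Since `η₁² (2 - k²) = η₁² + η₂²`, this is the relation `hsum` divided by `2 (1 - c²)`.
  have hν : (η₁ / √(2 * (1 - c ^ 2))) ^ 2 * (2 - (η₁ ^ 2 - η₂ ^ 2) / η₁ ^ 2) =
      -(ω + c ^ 2 / 4) := by
    rw [hs]
    field_simp
    linarith
  have hψ : ∀ x, dnoidalPsi c η₁ η₂ x = -2 * (η₁ / √(2 * (1 - c ^ 2))) ^ 2 *
      jacobiDn (η₁ / √(2 * (1 - c ^ 2)) * x) (dnoidalModulus η₁ η₂) ^ 2 := fun x => by
    rw [hs, dnoidalPsi, mul_div_right_comm]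
    field_simp
  have hφ : dnoidalPhi c η₁ η₂ =
      fun x => η₁ * jacobiDn (η₁ / √(2 * (1 - c ^ 2)) * x) (dnoidalModulus η₁ η₂) := by
    funext x
    rw [dnoidalPhi, mul_div_right_comm]
  rw [hφ]
  refine ⟨h.lame_spectrum (fun x => ?_) hη₁.ne', h.lame_one_spectrum (fun x => ?_) hη₁⟩
  · rw [hψ, hν]; ring
  · rw [hψ, hν]; ring
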